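/- Let $f:2^U\to\mathbb R$ be a non-negative monotone submodular function on a finite ground set $U$ with $|U|=n$, let each $u\in U$ have a size $c_u\ge 0$, let $B\ge 0$, and let $\mathcal M_j=(U,\mathcal F_j)$, $1\le j\le k$, be matroids on $U$. Consider $$\max\Bigl\{f(S):\ S\in\bigcap_{j=1}^k\mathcal F_j,\ c(S)\le B\Bigr\},\qquad c(S)=\sum_{u\in S}c_u .$$ For $\varepsilon>0$ the modified algorithm $k$-MatKnap is as follows. For every feasible guess $Y\subseteq U$ with $|Y|\le 2$ it computes a set $R_Y$; it returns an $R_Y$ of largest value. If $|Y|\le 1$, then $R_Y=Y$. If $|Y|=2$, it starts with $S=Y$ and performs greedy $k$-swaps: a pair $(x,\bar y)$ with $x\in U\setminus S$, $\bar y\subseteq S\setminus Y$, $|\bar y|\le k$ is admissible if $S'=(S\setminus\bar y)\cup\{x\}$ lies in $\bigcap_j\mathcal F_j$, $f(S')>f(S)$, $c(S)-c(\bar y)+c_x\le B$ and, unless $\bar y=\emptyset$, $f(S')\ge(1+\varepsilon/n^2)f(S)$. An admissible pair of maximum density $(f(S')-f(S))/c_x$ (which is $\infty$ if $c_x=0$;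 ties are broken arbitrarily) is chosen and $S$ is replaced by $S'$. This is repeated until there is no admissible pair or $f(S)>\frac n2 f(Y)$, and then $R_Y=S$. Theorem. For every fixed $k\ge 1$ there is an $\varepsilon>0$ such that, on every instance, every possible output $S$ of the modified algorithm is feasible and satisfies $$f(S)\ \ge\ \frac{1-e^{-(k+1)}}{k+1}\,f(O)\qquad\text{for every feasible } O,$$ and the modified algorithm can be implemented by a single program (depending only on $k$) which halts on all instances with $|U|=n$ within $\tilde O(n^{k+5})$ steps, that is, $O(n^{k+5}\log^d n)$ steps for some constant $d$. A step is an elementary operation on an index, on a real number, or on one element of a set (stored as a bit vector), or a call to the value oracle for $f$ or to the independence oracle of one of the matroids. -/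

import Mathlib

namespace MatKnap

/-! ## The optimization problem -/

/-- An instance with ground set `Fin n`: a nonnegative monotone submodular function `f`,
nonnegative sizes `c`, a size bound `B`, and `k` matroids on the ground set. -/
structure Problem (k n : ℕ) where
  f : Finset (Fin n) → ℝ
  c : Fin n → ℝ
  B : ℝ
  matroid : Fin k → Matroid (Fin n)
  f_nonneg : ∀ S, 0 ≤ f S
  f_mono : ∀ S T, S ⊆ T → f S ≤ f T
  f_submodular : ∀ R T, f (R ∪ T) + f (R ∩ T) ≤ f R + f T
  c_nonneg : ∀ u, 0 ≤ c u
  B_nonneg : 0 ≤ B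
  ground : ∀ j, (matroid j).E = Set.univ

namespace Problem

variable {k n : ℕ} (I : Problem k n)

/-- The total size of a set of elements. -/
def size (S : Finset (Fin n)) : ℝ := ∑ u ∈ S, I.c u

/-- Independence in all `k` matroids. -/
def Indep (S : Finset (Fin n)) : Prop := ∀ j, (I.matroid j).Indep (S : Set (Fin n))

def Feasible (S : Finset (Fin n)) : Prop := I.Indep S ∧ I.size S ≤ I.B

/-! ## Greedy approximate-improvement `k`-swaps -/

/-- The set that results from `S` when `x` is added and the elements of `y` are removed. -/
def swapped (S : Finset (Fin n)) (x : Fin n) (y : Finset (Fin n)) : Finset (Fin n) :=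
  (S \ y) ∪ {x}

/-- `(x, y)` is a `k`-swap for `S`: one element in, at most `k` elements out. -/
def IsSwap (S : Finset (Fin n)) (x : Fin n) (y : Finset (Fin n)) : Prop :=
  x ∉ S ∧ y ⊆ S ∧ y.card ≤ k ∧ I.Indep (swapped S x y)

/-- The marginal profit density of a swap. It is only used to compare swaps of positive
marginal profit, and such a swap has infinite density if the added element has size `0`. -/
noncomputable def density (S : Finset (Fin n)) (x : Fin n) (y : Finset (Fin n)) : EReal :=
  if I.c x = 0 then ⊤ else (((I.f (swapped S x y) - I.f S) / I.c x : ℝ) : EReal)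

/-- The swap `(x, y)` may be performed on the current set `S`, for the guess `Y`: it keeps `Y`,
it has positive marginal profit, it respects the size bound and, if it removes an element, it
increases the value by a factor of at least `1 + ε / n ^ 2`. -/
def Admissible (ε : ℝ) (Y S : Finset (Fin n)) (x : Fin n) (y : Finset (Fin n)) : Prop :=
  I.IsSwap S x y ∧ Disjoint y Y ∧ 0 < I.f (swapped S x y) - I.f S ∧
    I.c x - I.size y + I.size S ≤ I.B ∧
    (y ≠ ∅ → (1 + ε / (n : ℝ) ^ 2) * I.f S ≤ I.f (swapped S x y))

/-- One greedy swap: an admissible swap of maximum density is performed. (This is the first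
admissible swap when the swaps are popped in the order of non-increasing density; ties are
broken arbitrarily.) -/
def GreedySwap (ε : ℝ) (Y S S' : Finset (Fin n)) : Prop :=
  ∃ x y, I.Admissible ε Y S x y ∧
    (∀ x' y', I.Admissible ε Y S x' y' → I.density S x' y' ≤ I.density S x y) ∧
    S' = swapped S x y

/-- The current value `f S` exceeds `(n / 2) f Y`, which shows that `Y` does not consist of the
first two elements, in greedy order, of an optimal solution. -/
def GuessRefuted (Y S : Finset (Fin n)) : Prop := (n : ℝ) / 2 * I.f Y < I.f S

/-- A run from the guess `Y` may end with `S`: starting with `Y`, greedy swaps are performed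
until there is no admissible swap or the guess is refuted. -/
def GreedyRun (ε : ℝ) (Y S : Finset (Fin n)) : Prop :=
  Relation.ReflTransGen
    (fun S₁ S₂ => ¬ I.GuessRefuted Y S₁ ∧ I.GreedySwap ε Y S₁ S₂) Y S ∧
  (I.GuessRefuted Y S ∨ ∀ x y, ¬ I.Admissible ε Y S x y)

/-- The set found for the guess `Y`: a guess of two elements is extended by greedy swaps, a guess
of fewer elements (for an optimal solution with fewer than two elements) is kept as it is. -/
def GuessResult (ε : ℝ) (Y S : Finset (Fin n)) : Prop :=
  if Y.card = 2 then I.GreedyRun ε Y S else S = Y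

/-- All feasible guesses of at most two elements are tried. -/
def IsGuess (Y : Finset (Fin n)) : Prop := Y.card ≤ 2 ∧ I.Feasible Y

/-- `S` is a possible output of the modified algorithm: a set of largest value among the sets
found for the guesses. -/
def IsOutput (ε : ℝ) (S : Finset (Fin n)) : Prop :=
  ∃ R : Finset (Fin n) → Finset (Fin n),
    (∀ Y, I.IsGuess Y → I.GuessResult ε Y (R Y)) ∧
    (∃ Y, I.IsGuess Y ∧ S = R Y) ∧
    ∀ Y, I.IsGuess Y → I.f (R Y) ≤ I.f S

end Problem

/-! ## The machine model: unit-cost programs over reals with oracles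

A program has finitely many registers in use, of three sorts: indices (natural numbers), real
numbers and subsets of the ground set (bit vectors with random access). Every instruction, every
test and every oracle call takes one step. Index registers only support counting; real registers
support addition, subtraction, multiplication and comparison. -/

/-- The memory: index registers, real registers, and set registers. -/
structure State (n : ℕ) where
  idx : ℕ → ℕ
  real : ℕ → ℝ
  sets : ℕ → Finset (Fin n)

/-- The initial memory. -/
def State.init (n : ℕ) : State n := ⟨fun _ => 0, fun _ => 0, fun _ => ∅⟩

namespace State

variable {n : ℕ}

def setIdx (σ : State n) (i v : ℕ) : State n :=
  { σ with idx := Function.update σ.idx i v }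

noncomputable def setReal (σ : State n) (r : ℕ) (v : ℝ) : State n :=
  { σ with real := Function.update σ.real r v }

def setSet (σ : State n) (s : ℕ) (v : Finset (Fin n)) : State n :=
  { σ with sets := Function.update σ.sets s v }

end State

/-- Atomic instructions. The arguments are register numbers, except for the numeral `m`. -/
inductive Instr where
  /-- index `i` := 0 -/
  | zero (i : ℕ)
  /-- index `i` := index `i` + 1 -/
  | succ (i : ℕ)
  /-- index `i` := index `i` - 1, and 0 stays 0 -/
  | pred (i : ℕ)
  /-- index `i` := index `j` -/
  | copy (i j : ℕ)
  /-- index `i` := number of elements of the ground set -/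
  | groundSize (i : ℕ)
  /-- real `r` := numeral `m` -/
  | lit (r m : ℕ)
  /-- real `r` := real `a` -/
  | move (r a : ℕ)
  /-- real `r` := real `a` + real `b` -/
  | plus (r a b : ℕ)
  /-- real `r` := real `a` - real `b` -/
  | minus (r a b : ℕ)
  /-- real `r` := real `a` * real `b` -/
  | times (r a b : ℕ)
  /-- real `r` := size bound -/
  | bound (r : ℕ)
  /-- real `r` := size of the element whose number is in index `i` (0 if there is none) -/
  | cost (r i : ℕ)
  /-- real `r` := value of the set in set register `s` (value oracle) -/
  | value (r s : ℕ)
  /-- insert the element whose number is in index `i` into set `s` -/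
  | insert (s i : ℕ)
  /-- erase the element whose number is in index `i` from set `s` -/
  | erase (s i : ℕ)

/-- Atomic tests. -/
inductive Test (k : ℕ) where
  /-- index `i` = index `j` -/
  | idxEq (i j : ℕ)
  /-- index `i` < index `j` -/
  | idxLt (i j : ℕ)
  /-- real `a` < real `b` -/
  | realLt (a b : ℕ)
  /-- set `s` contains the element whose number is in index `i` -/
  | mem (s i : ℕ)
  /-- set `s` is independent in matroid `j` (independence oracle) -/
  | indep (j : Fin k) (s : ℕ)

/-- Programs, for `k` matroids. -/
inductive Program (k : ℕ) where
  | skip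
  | op (a : Instr)
  | seq (p q : Program k)
  | ite (b : Test k) (p q : Program k)
  | loop (b : Test k) (p : Program k)

variable {k n : ℕ}

/-- The effect of an instruction. -/
noncomputable def Instr.apply (I : Problem k n) (σ : State n) : Instr → State n
  | .zero i => σ.setIdx i 0
  | .succ i => σ.setIdx i (σ.idx i + 1)
  | .pred i => σ.setIdx i (σ.idx i - 1)
  | .copy i j => σ.setIdx i (σ.idx j)
  | .groundSize i => σ.setIdx i n
  | .lit r m => σ.setReal r m
  | .move r a => σ.setReal r (σ.real a)
  | .plus r a b => σ.setReal r (σ.real a + σ.real b)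
  | .minus r a b => σ.setReal r (σ.real a - σ.real b)
  | .times r a b => σ.setReal r (σ.real a * σ.real b)
  | .bound r => σ.setReal r I.B
  | .cost r i => σ.setReal r (if h : σ.idx i < n then I.c ⟨σ.idx i, h⟩ else 0)
  | .value r s => σ.setReal r (I.f (σ.sets s))
  | .insert s i =>
      if h : σ.idx i < n then σ.setSet s (Insert.insert ⟨σ.idx i, h⟩ (σ.sets s)) else σ
  | .erase s i =>
      if h : σ.idx i < n then σ.setSet s ((σ.sets s).erase ⟨σ.idx i, h⟩) else σ

/-- The truth value of a test. -/
def Test.Holds (I : Problem k n) (σ : State n) : Test k → Prop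
  | .idxEq i j => σ.idx i = σ.idx j
  | .idxLt i j => σ.idx i < σ.idx j
  | .realLt a b => σ.real a < σ.real b
  | .mem s i => ∃ h : σ.idx i < n, (⟨σ.idx i, h⟩ : Fin n) ∈ σ.sets s
  | .indep j s => (I.matroid j).Indep (σ.sets s : Set (Fin n))

/-- `Exec I p σ t τ`: on the instance `I`, the program `p`, started with memory `σ`, halts after
exactly `t` steps with memory `τ`. -/
inductive Exec (I : Problem k n) : Program k → State n → ℕ → State n → Prop where
  | skip (σ) : Exec I .skip σ 1 σ
  | op (a σ) : Exec I (.op a) σ 1 (a.apply I σ)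
  | seq {p q σ τ υ t u} : Exec I p σ t τ → Exec I q τ u υ → Exec I (.seq p q) σ (t + u) υ
  | ite_true {b p q σ τ t} : b.Holds I σ → Exec I p σ t τ → Exec I (.ite b p q) σ (t + 1) τ
  | ite_false {b p q σ τ t} : ¬ b.Holds I σ → Exec I q σ t τ → Exec I (.ite b p q) σ (t + 1) τ
  | loop_done {b p σ} : ¬ b.Holds I σ → Exec I (.loop b p) σ 1 σ
  | loop_step {b p σ τ υ t u} : b.Holds I σ → Exec I p σ t τ → Exec I (.loop b p) τ u υ →
      Exec I (.loop b p) σ (t + u + 1) υ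

/-- The program `p` halts on `I` after exactly `t` steps with output `S` (in set register 0). -/
def Computes (I : Problem k n) (p : Program k) (t : ℕ) (S : Finset (Fin n)) : Prop :=
  ∃ τ, Exec I p (State.init n) t τ ∧ τ.sets 0 = S

/-- `T` is `Õ(g)`: it is `O(g)` up to a poly-logarithmic factor. -/
def SoftO (T : ℕ → ℕ) (g : ℕ → ℝ) : Prop :=
  ∃ d : ℕ, (fun m => (T m : ℝ)) =O[Filter.atTop] fun m => g m * Real.log m ^ d

end MatKnap

namespace MatKnap

/-! Approximation. Fix a feasible `O` with at least two elements and let `Y` be its first two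
elements in greedy order; `Y` is one of the guesses. For a current set `S ⊇ Y`, matroid exchange
(`exists_exchange`) gives each `x ∈ O \ S` at most one element to remove per matroid, no element
being used twice within a matroid. By submodularity the resulting swaps have total gain at least `f
O + k f Y - (k + 1) f S` (`exists_swaps`). With `ε = 1/4`, discarding the swaps that improve too
little costs at most `f Y / 8` while the guess is not refuted. Averaging over the sizes in `O \ Y`
yields a swap of density at least `g / C`, where `g = f O + (k - 1/8) f Y - (k + 1) f S` and `C =
c(O \ Y)` (`greedy_step`).

So while `g > 0` and the dense swap fits, adding `x` greedily contracts the gap `g` by a factor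
`exp(-(k + 1) c x / C)`. If the dense swap overflows the size bound, then the sizes added so far
together with that of `x` reach `C`, and performing this swap would bring the gap down to at most
`exp(-(k + 1))` times its initial value (`run_progress`). The fictitious swap gains at most `f Y /
2` by the choice of `Y`, and the surplus terms in `f Y` pay for it (`half_le_ratio_slack`). A
refuted guess is harmless, because then `f S` exceeds `f O` (`value_le_of_greedy_pair`).

Running time. A swap with a removal multiplies `f` by at least `1 + 1/(4n²)`, and an unrefuted value
is at most `(n/2) f Y`, so there are `O(n² log n)` such swaps. Insertions without removal are
controlled by cardinality (`Trace.counts`). One round scans `O(n^(k+1))` swaps and there are `O(n²)`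
guesses, hence `O(n^(k+5) log n)` steps. An explicit program is verified with the timed correctness
predicate `Reach`. -/

/-! ### Matroid exchange. -/

/-- Exchange between two independent sets: every element of `O \ S` can be added to `S` after
the removal of at most one element of `S \ O`, and no element is removed twice. -/
theorem exists_exchange {α : Type*} [DecidableEq α] (M : Matroid α) {S O : Finset α}
    (hS : M.Indep (S : Set α)) (hO : M.Indep (O : Set α)) :
    ∃ π : α → Finset α,
      (∀ x ∈ O \ S, π x ⊆ S \ O ∧ (π x).card ≤ 1 ∧ M.Indep (insert x ((S : Set α) \ π x))) ∧
      ∀ u, ∀ x ∈ O \ S, ∀ x' ∈ O \ S, u ∈ π x → u ∈ π x' → x = x' := by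
  classical
  let ι := {x : α // x ∈ O \ S ∧ ¬ M.Indep (insert x (S : Set α))}
  -- Removing any element of the fundamental circuit of `x` restores independence. Distinct choices
  -- outside `O` are a system of distinct representatives, which Hall's theorem provides.
  let t : ι → Finset α := fun x => (S \ O).filter fun u => u ∈ M.fundCircuit x.1 S
  have hx : ∀ x : ι, x.1 ∈ O ∧ x.1 ∉ S ∧ x.1 ∈ M.closure (S : Set α) := by
    rintro ⟨x, hx, hd⟩
    rw [Finset.mem_sdiff] at hx
    refine ⟨hx.1, hx.2, ?_⟩
    by_contra hcl
    exact hd ((hS.insert_indep_iff).2 (Or.inl ⟨hO.subset_ground hx.1, hcl⟩))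
  -- If `s` violates Hall's condition, then `J ⊆ O` is larger than `K ⊆ S`, and augmentation adds
  -- some `x ∈ s` to `K`. But the circuit of `x` lies in `K + x`: its part outside `O` is `t x`, the
  -- rest is in `S ∩ O`.
  have hall : ∀ s : Finset ι, s.card ≤ (s.biUnion t).card := by
    intro s
    by_contra! hlt
    let A : Finset α := s.map ⟨Subtype.val, Subtype.val_injective⟩
    let J : Finset α := A ∪ (S ∩ O)
    let K : Finset α := s.biUnion t ∪ (S ∩ O)
    have hAO : ∀ a ∈ A, ∃ x ∈ s, x.1 = a := by
      intro a ha
      obtain ⟨x, hxs, rfl⟩ := Finset.mem_map.1 ha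
      exact ⟨x, hxs, rfl⟩
    have hJ : M.Indep (J : Set α) := by
      refine hO.subset ?_
      intro a ha
      rcases Finset.mem_union.1 (Finset.mem_coe.1 ha) with h | h
      · obtain ⟨x, -, rfl⟩ := hAO a h
        exact (hx x).1
      · exact (Finset.mem_inter.1 h).2
    have hK : M.Indep (K : Set α) := by
      refine hS.subset ?_
      intro a ha
      rcases Finset.mem_union.1 (Finset.mem_coe.1 ha) with h | h
      · obtain ⟨x, -, hxa⟩ := Finset.mem_biUnion.1 h
        exact (Finset.mem_sdiff.1 (Finset.mem_filter.1 hxa).1).1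
      · exact (Finset.mem_inter.1 h).1
    have hcard : K.card < J.card := by
      have h1 : J.card = A.card + (S ∩ O).card := by
        refine Finset.card_union_of_disjoint (Finset.disjoint_left.2 ?_)
        intro a ha h
        obtain ⟨x, -, rfl⟩ := hAO a ha
        exact (hx x).2.1 (Finset.mem_inter.1 h).1
      have h2 : K.card ≤ (s.biUnion t).card + (S ∩ O).card := Finset.card_union_le _ _
      have h3 : A.card = s.card := Finset.card_map _
      omega
    obtain ⟨e, heJ, heK, hind⟩ := hK.augment_finset hJ hcard
    have heA : e ∈ A := by
      rcases Finset.mem_union.1 heJ with h | h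
      · exact h
      · exact absurd (Finset.mem_union_right _ h) heK
    obtain ⟨x, hxs, rfl⟩ := hAO e heA
    refine (hS.fundCircuit_isCircuit (hx x).2.2 (hx x).2.1).not_indep (hind.subset ?_)
    intro u hu
    rcases M.fundCircuit_subset_insert _ _ hu with rfl | huS
    · simp
    · have huK : u ∈ K := by
        by_cases huO : u ∈ O
        · exact Finset.mem_union_right _ (Finset.mem_inter.2 ⟨huS, huO⟩)
        · exact Finset.mem_union_left _ (Finset.mem_biUnion.2 ⟨x, hxs,
            Finset.mem_filter.2 ⟨Finset.mem_sdiff.2 ⟨huS, huO⟩, hu⟩⟩)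
      simp [huK]
  obtain ⟨g, hg, hgt⟩ := (Finset.all_card_le_biUnion_card_iff_exists_injective t).1 hall
  refine ⟨fun x => if h : x ∈ O \ S ∧ ¬ M.Indep (insert x (S : Set α)) then {g ⟨x, h⟩} else ∅,
    ?_, ?_⟩
  · intro x hxm
    by_cases h : M.Indep (insert x (S : Set α))
    · simp [h]
    · have hh : x ∈ O \ S ∧ ¬ M.Indep (insert x (S : Set α)) := ⟨hxm, h⟩
      have hm := Finset.mem_filter.1 (hgt ⟨x, hh⟩)
      simp only [dif_pos hh]
      refine ⟨Finset.singleton_subset_iff.2 hm.1, by simp, ?_⟩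
      have := (hS.mem_fundCircuit_iff (hx ⟨x, hh⟩).2.2 (hx ⟨x, hh⟩).2.1).1 hm.2
      refine this.subset ?_
      intro u hu
      have hne : x ≠ g ⟨x, hh⟩ := by
        intro he
        have := (Finset.mem_sdiff.1 hm.1).1
        rw [← he] at this
        exact (hx ⟨x, hh⟩).2.1 this
      rcases hu with rfl | hu
      · exact ⟨Set.mem_insert _ _, hne⟩
      · exact ⟨Set.mem_insert_of_mem _ hu.1, by simpa using hu.2⟩
  · intro u x hxm x' hxm' hu hu'
    dsimp only at hu hu'
    split_ifs at hu hu' with h h'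
    · have h1 := Finset.mem_singleton.1 hu
      have h2 := Finset.mem_singleton.1 hu'
      exact congrArg Subtype.val (hg (h1.symm.trans h2))
    all_goals simp_all

/-! ### Marginal values of submodular functions. -/

/-- Marginal values along an enumeration of `S \ Y` bound the loss caused by removals. -/
theorem exists_removal_weights {α : Type*} [DecidableEq α] (f : Finset α → ℝ)
    (hmono : ∀ S T, S ⊆ T → f S ≤ f T)
    (hsub : ∀ R T, f (R ∪ T) + f (R ∩ T) ≤ f R + f T) (Y D : Finset α) :
    Disjoint D Y →
    ∃ w : α → ℝ, (∀ u, 0 ≤ w u) ∧ ∑ u ∈ D, w u = f (Y ∪ D) - f Y ∧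
      ∀ A ⊆ D, f (Y ∪ D) - f ((Y ∪ D) \ A) ≤ ∑ u ∈ A, w u := by
  induction D using Finset.induction_on with
  | empty =>
    intro _
    refine ⟨fun _ => 0, by simp, by simp, ?_⟩
    intro A hA
    simp [Finset.subset_empty.1 hA]
  | insert a D ha ih =>
    intro hd
    rw [Finset.disjoint_insert_left] at hd
    obtain ⟨w, hw0, hws, hwA⟩ := ih hd.2
    have heq : Y ∪ insert a D = insert a (Y ∪ D) := by ext; simp
    -- The new element comes last in the enumeration, so its weight is its marginal value over all
    -- of `Y ∪ D`.
    refine ⟨Function.update w a (f (Y ∪ insert a D) - f (Y ∪ D)), ?_, ?_, ?_⟩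
    · intro u
      by_cases h : u = a
      · subst h
        have := hmono (Y ∪ D) (Y ∪ insert u D) (by rw [heq]; exact Finset.subset_insert _ _)
        simpa using this
      · simpa [Function.update_of_ne h] using hw0 u
    · rw [Finset.sum_insert ha, Function.update_self, Finset.sum_congr rfl
        (fun u hu => Function.update_of_ne (ne_of_mem_of_not_mem hu ha) _ _), hws]
      ring
    · intro A hA
      have haYD : a ∉ Y ∪ D := by simp [ha, hd.1]
      by_cases haA : a ∈ A
      · have h1 := hwA (A.erase a) (by
          intro u hu
          have := hA (Finset.mem_of_mem_erase hu)
          exact (Finset.mem_insert.1 this).resolve_left (Finset.ne_of_mem_erase hu))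
        have h2 : (Y ∪ insert a D) \ A = (Y ∪ D) \ A.erase a := by
          rw [heq]; ext u
          by_cases hu : u = a
          · subst hu; simp only [Finset.mem_sdiff, haYD, Finset.mem_erase]; simp [haA]
          · simp [hu]
        rw [h2, ← Finset.add_sum_erase _ _ haA, Function.update_self, Finset.sum_congr rfl
          (fun u hu => Function.update_of_ne (Finset.ne_of_mem_erase hu) _ _)]
        linarith
      · have hAD : A ⊆ D := fun u hu =>
          (Finset.mem_insert.1 (hA hu)).resolve_left (ne_of_mem_of_not_mem hu haA)
        rw [Finset.sum_congr rfl
          (fun u hu => Function.update_of_ne (ne_of_mem_of_not_mem hu haA) _ _)]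
        have h1 := hwA A hAD
        -- Here `a` survives the removal of `A`. Its marginal value over the reduced set is no
        -- smaller than over `Y ∪ D`, so the loss does not grow.
        have h2 := hsub (insert a ((Y ∪ D) \ A)) (Y ∪ D)
        have h3 : insert a ((Y ∪ D) \ A) ∪ (Y ∪ D) = Y ∪ insert a D := by
          rw [heq]; ext u; simp; tauto
        have h4 : insert a ((Y ∪ D) \ A) ∩ (Y ∪ D) = (Y ∪ D) \ A := by
          ext u
          by_cases hu : u = a
          · subst hu; simp only [Finset.mem_inter, Finset.mem_sdiff, haYD]; simp
          · simp [hu]; tauto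
        have h5 : (Y ∪ insert a D) \ A = insert a ((Y ∪ D) \ A) := by
          rw [heq, Finset.insert_sdiff_of_notMem _ haA]
        rw [h3, h4] at h2
        rw [h5]
        linarith

/-- The marginal value of a set is at most the sum of the marginal values of its elements. -/
theorem sum_marginal_ge {α : Type*} [DecidableEq α] (f : Finset α → ℝ)
    (hmono : ∀ S T, S ⊆ T → f S ≤ f T)
    (hsub : ∀ R T, f (R ∪ T) + f (R ∩ T) ≤ f R + f T) (S A : Finset α) :
    f (S ∪ A) - f S ≤ ∑ x ∈ A, (f (insert x S) - f S) := by
  induction A using Finset.induction_on with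
  | empty => simp
  | insert a A ha ih =>
    rw [Finset.sum_insert ha]
    have h1 := hsub (insert a S) (S ∪ A)
    have h2 : insert a S ∪ (S ∪ A) = S ∪ insert a A := by ext; simp
    have h3 := hmono S (insert a S ∩ (S ∪ A)) (by
      intro u hu; simp [hu])
    rw [h2] at h1
    linarith

/-- Marginal values decrease. -/
theorem marginal_antitone {α : Type*} [DecidableEq α] (f : Finset α → ℝ)
    (hmono : ∀ S T, S ⊆ T → f S ≤ f T)
    (hsub : ∀ R T, f (R ∪ T) + f (R ∩ T) ≤ f R + f T) {S T : Finset α} (hST : S ⊆ T) (x : α) :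
    f (insert x T) - f T ≤ f (insert x S) - f S := by
  have h1 := hsub (insert x S) T
  have h2 : insert x S ∪ T = insert x T := by
    rw [Finset.insert_union, Finset.union_eq_right.2 hST]
  have h3 := hmono S (insert x S ∩ T) (by
    intro u hu; simp [hu, hST hu])
  rw [h2] at h1
  linarith

/-! ### Swaps and the greedy step. -/

namespace Problem

variable {k n : ℕ} (I : Problem k n)

/-- The marginal profit of a swap. -/
def gain (S : Finset (Fin n)) (x : Fin n) (y : Finset (Fin n)) : ℝ :=
  I.f (swapped S x y) - I.f S

/-- Cross-multiplication remains correct for elements of size 0 because both gains are positive.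
This form feeds the averaging argument and is also what the program tests, as its instructions
include no division. -/
theorem density_le_iff {S : Finset (Fin n)} {x x' : Fin n} {y y' : Finset (Fin n)}
    (h : 0 < I.gain S x y) (h' : 0 < I.gain S x' y') :
    I.density S x y ≤ I.density S x' y' ↔
      I.gain S x y * I.c x' ≤ I.gain S x' y' * I.c x := by
  have hc := I.c_nonneg x
  have hc' := I.c_nonneg x'
  unfold density
  change (if I.c x = 0 then (⊤ : EReal) else ((I.gain S x y / I.c x : ℝ) : EReal)) ≤
    (if I.c x' = 0 then (⊤ : EReal) else ((I.gain S x' y' / I.c x' : ℝ) : EReal)) ↔ _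
  by_cases h0 : I.c x = 0
  · by_cases h0' : I.c x' = 0
    · simp [h0, h0']
    · have : 0 < I.c x' := lt_of_le_of_ne hc' (Ne.symm h0')
      rw [if_pos h0, if_neg h0', top_le_iff, h0, mul_zero]
      simp only [EReal.coe_ne_top, false_iff, not_le]
      positivity
  · by_cases h0' : I.c x' = 0
    · simp only [h0', if_true, le_top, mul_zero, true_iff]
      positivity
    · have hp : 0 < I.c x := lt_of_le_of_ne hc (Ne.symm h0)
      have hp' : 0 < I.c x' := lt_of_le_of_ne hc' (Ne.symm h0')
      rw [if_neg h0, if_neg h0', EReal.coe_le_coe_iff, div_le_div_iff₀ hp hp']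

theorem size_nonneg (S : Finset (Fin n)) : 0 ≤ I.size S :=
  Finset.sum_nonneg fun u _ => I.c_nonneg u

theorem size_mono {S T : Finset (Fin n)} (h : S ⊆ T) : I.size S ≤ I.size T :=
  Finset.sum_le_sum_of_subset_of_nonneg h fun u _ _ => I.c_nonneg u

theorem size_insert {S : Finset (Fin n)} {x : Fin n} (hx : x ∉ S) :
    I.size (insert x S) = I.c x + I.size S := Finset.sum_insert hx

theorem size_sdiff {S y : Finset (Fin n)} (hy : y ⊆ S) :
    I.size (S \ y) = I.size S - I.size y := by
  have := Finset.sum_sdiff (f := I.c) hy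
  unfold size
  linarith

theorem swapped_eq_insert (S : Finset (Fin n)) (x : Fin n) (y : Finset (Fin n)) :
    swapped S x y = insert x (S \ y) := by
  unfold swapped; ext; simp

theorem size_swapped {S y : Finset (Fin n)} {x : Fin n} (hx : x ∉ S) (hy : y ⊆ S) :
    I.size (swapped S x y) = I.c x - I.size y + I.size S := by
  rw [swapped_eq_insert, I.size_insert (by simp [hx]), I.size_sdiff hy]
  ring

theorem Indep.mono {I : Problem k n} {S T : Finset (Fin n)} (h : I.Indep T) (hST : S ⊆ T) :
    I.Indep S := fun j => (h j).subset (Finset.coe_subset.2 hST)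

theorem Feasible.mono {I : Problem k n} {S T : Finset (Fin n)} (h : I.Feasible T) (hST : S ⊆ T) :
    I.Feasible S := ⟨h.1.mono hST, (I.size_mono hST).trans h.2⟩

theorem feasible_empty : I.Feasible ∅ :=
  ⟨fun j => by simp, by simpa [size] using I.B_nonneg⟩

theorem Admissible.feasible {I : Problem k n} {ε : ℝ} {Y S y : Finset (Fin n)} {x : Fin n}
    (h : I.Admissible ε Y S x y) : I.Feasible (swapped S x y) :=
  ⟨h.1.2.2.2, by rw [I.size_swapped h.1.1 h.1.2.1]; exact h.2.2.2.1⟩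

theorem Admissible.gain_pos {I : Problem k n} {ε : ℝ} {Y S y : Finset (Fin n)} {x : Fin n}
    (h : I.Admissible ε Y S x y) : 0 < I.gain S x y := h.2.2.1

theorem subset_swapped {Y S y : Finset (Fin n)} (x : Fin n) (hYS : Y ⊆ S) (hd : Disjoint y Y) :
    Y ⊆ swapped S x y := by
  intro u hu
  rw [swapped_eq_insert]
  exact Finset.mem_insert_of_mem
    (Finset.mem_sdiff.2 ⟨hYS hu, fun h => Finset.disjoint_left.1 hd h hu⟩)

/-- For independent `S` and `O`, the elements of `O \ S` take part in swaps of large total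
marginal profit. -/
theorem exists_swaps {S O Y : Finset (Fin n)} (hS : I.Indep S) (hO : I.Indep O) (hYS : Y ⊆ S)
    (hYO : Y ⊆ O) :
    ∃ r : Fin n → Finset (Fin n),
      (∀ x ∈ O \ S, I.IsSwap S x (r x) ∧ Disjoint (r x) Y) ∧
      I.f O + k * I.f Y - (k + 1) * I.f S ≤ ∑ x ∈ O \ S, I.gain S x (r x) := by
  classical
  choose π hπ hπ' using fun j => exists_exchange (I.matroid j) (hS j) (hO j)
  -- One swap must repair all matroids at once, so the removals they ask for are united.
  let r : Fin n → Finset (Fin n) := fun x => Finset.univ.biUnion fun j => π j x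
  have hr : ∀ x ∈ O \ S, r x ⊆ S \ O := fun x hx =>
    Finset.biUnion_subset.2 fun j _ => (hπ j x hx).1
  have hrS : ∀ x ∈ O \ S, r x ⊆ S := fun x hx => (hr x hx).trans Finset.sdiff_subset
  have hrD : ∀ x ∈ O \ S, r x ⊆ S \ Y := fun x hx =>
    (hr x hx).trans (Finset.sdiff_subset_sdiff le_rfl hYO)
  refine ⟨r, ?_, ?_⟩
  · intro x hx
    refine ⟨⟨(Finset.mem_sdiff.1 hx).2, hrS x hx, ?_, ?_⟩, ?_⟩
    · calc (r x).card ≤ ∑ j, (π j x).card := Finset.card_biUnion_le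
        _ ≤ ∑ _j : Fin k, 1 := Finset.sum_le_sum fun j _ => (hπ j x hx).2.1
        _ = k := by simp
    · intro j
      refine (hπ j x hx).2.2.subset ?_
      rw [swapped_eq_insert]
      intro u hu
      rcases Finset.mem_insert.1 (Finset.mem_coe.1 hu) with rfl | hu
      · exact Set.mem_insert _ _
      · rw [Finset.mem_sdiff] at hu
        exact Set.mem_insert_of_mem _ ⟨hu.1, fun h =>
          hu.2 (Finset.mem_biUnion.2 ⟨j, Finset.mem_univ _, h⟩)⟩
    · exact Finset.disjoint_left.2 fun u hu hY => (Finset.mem_sdiff.1 (hrD x hx hu)).2 hY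
  · obtain ⟨w, hw0, hws, hwA⟩ := exists_removal_weights I.f I.f_mono I.f_submodular Y (S \ Y)
      Finset.sdiff_disjoint
    rw [Finset.union_sdiff_of_subset hYS] at hws hwA
    have hstep : ∀ x ∈ O \ S,
        (I.f (insert x S) - I.f S) - ∑ u ∈ r x, w u ≤ I.gain S x (r x) := by
      intro x hx
      have h1 := hwA (r x) (hrD x hx)
      have h2 := marginal_antitone I.f I.f_mono I.f_submodular
        (Finset.sdiff_subset (s := S) (t := r x)) x
      unfold gain
      rw [swapped_eq_insert]
      linarith
    have hadd : I.f O - I.f S ≤ ∑ x ∈ O \ S, (I.f (insert x S) - I.f S) := by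
      have h1 := sum_marginal_ge I.f I.f_mono I.f_submodular S (O \ S)
      have h2 := I.f_mono O (S ∪ (O \ S)) (by intro u hu; simp [hu])
      linarith
    -- For a fixed matroid the removed sets are disjoint parts of `S \ Y`, so their weights add up
    -- to at most `f S - f Y`. Each matroid contributes once, hence the factor `k`.
    have hrem : ∑ x ∈ O \ S, ∑ u ∈ r x, w u ≤ k * (I.f S - I.f Y) := by
      have h1 : ∀ x ∈ O \ S, ∑ u ∈ r x, w u ≤ ∑ j : Fin k, ∑ u ∈ π j x, w u := by
        intro x hx
        calc ∑ u ∈ r x, w u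
            ≤ ∑ u ∈ r x, ∑ j : Fin k, if u ∈ π j x then w u else 0 := by
              refine Finset.sum_le_sum fun u hu => ?_
              obtain ⟨j, -, hj⟩ := Finset.mem_biUnion.1 hu
              have := Finset.single_le_sum
                (f := fun j : Fin k => if u ∈ π j x then w u else 0)
                (fun j _ => by split_ifs; exacts [hw0 u, le_rfl])
                (Finset.mem_univ j)
              simpa [hj] using this
          _ = ∑ j : Fin k, ∑ u ∈ r x, if u ∈ π j x then w u else 0 := Finset.sum_comm
          _ ≤ _ := by
              refine Finset.sum_le_sum fun j _ => ?_
              rw [← Finset.sum_filter]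
              refine Finset.sum_le_sum_of_subset_of_nonneg ?_ fun u _ _ => hw0 u
              intro u hu
              exact (Finset.mem_filter.1 hu).2
      calc ∑ x ∈ O \ S, ∑ u ∈ r x, w u
          ≤ ∑ x ∈ O \ S, ∑ j : Fin k, ∑ u ∈ π j x, w u := Finset.sum_le_sum h1
        _ = ∑ j : Fin k, ∑ x ∈ O \ S, ∑ u ∈ π j x, w u := Finset.sum_comm
        _ ≤ ∑ _j : Fin k, (I.f S - I.f Y) := by
            refine Finset.sum_le_sum fun j _ => ?_
            rw [← hws, ← Finset.sum_biUnion]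
            · refine Finset.sum_le_sum_of_subset_of_nonneg ?_ fun u _ _ => hw0 u
              exact Finset.biUnion_subset.2 fun x hx => ((hπ j x hx).1).trans
                (Finset.sdiff_subset_sdiff le_rfl hYO)
            · intro x hx x' hx' hne
              exact Finset.disjoint_left.2 fun u hu hu' => hne (hπ' j u x hx x' hx' hu hu')
        _ = k * (I.f S - I.f Y) := by simp [mul_sub]
    have := Finset.sum_le_sum hstep
    rw [Finset.sum_sub_distrib] at this
    linarith

/-- The step of the greedy analysis with parameter `1 / 4`: either `S` is good already, or the
greedy swap makes enough progress, or some swap makes enough progress but violates the size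
bound. -/
theorem greedy_step {S O Y : Finset (Fin n)} (hn : 0 < n) (hS : I.Indep S) (hO : I.Indep O)
    (hYS : Y ⊆ S) (hYO : Y ⊆ O) (href : ¬ I.GuessRefuted Y S) :
    let g := I.f O + (k - 1 / 8) * I.f Y - (k + 1) * I.f S
    let C := I.size (O \ Y)
    g ≤ 0 ∨
    ((∃ x y, I.Admissible (1 / 4) Y S x y) ∧
      ∀ x y, I.Admissible (1 / 4) Y S x y →
        (∀ x' y', I.Admissible (1 / 4) Y S x' y' → I.density S x' y' ≤ I.density S x y) →
        g * I.c x ≤ C * I.gain S x y) ∨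
    ∃ x ∈ O \ S, ∃ y ⊆ S, I.B < I.c x - I.size y + I.size S ∧ g * I.c x ≤ C * I.gain S x y := by
  classical
  intro g C
  obtain ⟨r, hr, hsum⟩ := I.exists_swaps hS hO hYS hYO
  have hn1 : (1 : ℝ) ≤ n := by exact_mod_cast hn
  let δ : ℝ := 1 / 4 / (n : ℝ) ^ 2 * I.f S
  have hδ : 0 ≤ δ := mul_nonneg (by positivity) (I.f_nonneg S)
  let G := (O \ S).filter fun x => 0 < I.gain S x (r x) ∧ (r x ≠ ∅ → δ ≤ I.gain S x (r x))
  have hGsub : G ⊆ O \ S := Finset.filter_subset _ _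
  -- The slack `1/8` in the gap arises here: at most `n` swaps are dropped, each with gain at most
  -- `δ = f S / (4n²)`, and `f S ≤ (n/2) f Y` as the guess is not refuted.
  have hnδ : n * δ ≤ 1 / 8 * I.f Y := by
    have h1 : I.f S ≤ n / 2 * I.f Y := not_lt.1 href
    have h2 : n * δ = 1 / 4 / n * I.f S := by
      simp only [δ]; field_simp
    rw [h2]
    calc 1 / 4 / (n : ℝ) * I.f S ≤ 1 / 4 / n * (n / 2 * I.f Y) := by gcongr
      _ = 1 / 8 * I.f Y := by field_simp; ring
  have hgG : g ≤ ∑ x ∈ G, I.gain S x (r x) := by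
    have h1 : ∑ x ∈ O \ S, I.gain S x (r x) ≤ ∑ x ∈ G, I.gain S x (r x) + n * δ := by
      rw [← Finset.sum_sdiff hGsub, add_comm]
      gcongr
      calc ∑ x ∈ (O \ S) \ G, I.gain S x (r x) ≤ ∑ _x ∈ (O \ S) \ G, δ := by
            refine Finset.sum_le_sum fun x hx => ?_
            rw [Finset.mem_sdiff] at hx
            by_contra! hlt
            exact hx.2 (Finset.mem_filter.2 ⟨hx.1, hδ.trans_lt hlt, fun _ => hlt.le⟩)
        _ = ((O \ S) \ G).card * δ := by simp
        _ ≤ n * δ := by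
            gcongr
            simpa using Finset.card_le_univ ((O \ S) \ G)
    simp only [g]
    linarith
  rcases G.eq_empty_or_nonempty with hG | hG
  · left
    simpa [hG] using hgG
  right
  -- Averaging: a swap at least as dense as every member of `G` has at least the density of the
  -- total gain over the total size, and the latter is at most `C`.
  have hkey : ∀ x' y', 0 < I.gain S x' y' →
      (∀ x ∈ G, I.density S x (r x) ≤ I.density S x' y') → g * I.c x' ≤ C * I.gain S x' y' := by
    intro x' y' hpos hle
    calc g * I.c x' ≤ (∑ x ∈ G, I.gain S x (r x)) * I.c x' :=
          mul_le_mul_of_nonneg_right hgG (I.c_nonneg _)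
      _ = ∑ x ∈ G, I.gain S x (r x) * I.c x' := Finset.sum_mul ..
      _ ≤ ∑ x ∈ G, I.gain S x' y' * I.c x := Finset.sum_le_sum fun x hx =>
          (I.density_le_iff (Finset.mem_filter.1 hx).2.1 hpos).1 (hle x hx)
      _ = I.gain S x' y' * I.size G := (Finset.mul_sum ..).symm
      _ ≤ I.gain S x' y' * C := by
          refine mul_le_mul_of_nonneg_left (I.size_mono ?_) hpos.le
          exact hGsub.trans (Finset.sdiff_subset_sdiff le_rfl hYS)
      _ = _ := mul_comm ..
  obtain ⟨x, hxG, hmax⟩ := Finset.exists_max_image G (fun x => I.density S x (r x)) hG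
  have hxm := Finset.mem_filter.1 hxG
  have hsw := hr x hxm.1
  -- The densest member of `G` can fail to be admissible only through the size bound.
  by_cases hB : I.B < I.c x - I.size (r x) + I.size S
  · right
    exact ⟨x, hxm.1, r x, hsw.1.2.1, hB, hkey x (r x) hxm.2.1 hmax⟩
  · left
    have hadm : I.Admissible (1 / 4) Y S x (r x) := by
      refine ⟨hsw.1, hsw.2, hxm.2.1, not_lt.1 hB, fun hne => ?_⟩
      have := hxm.2.2 hne
      simp only [δ, gain] at this
      linarith
    refine ⟨⟨x, r x, hadm⟩, fun x' y' hadm' hmax' => hkey x' y' hadm'.gain_pos fun z hz => ?_⟩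
    exact (hmax z hz).trans (hmax' _ _ hadm)

end Problem

/-! ### Numerical facts about the ratio. -/

/-- The approximation ratio. -/
noncomputable def ratio (k : ℕ) : ℝ := (1 - Real.exp (-((k : ℝ) + 1))) / ((k : ℝ) + 1)

theorem ratio_le (k : ℕ) : ratio k ≤ 1 / ((k : ℝ) + 1) := by
  unfold ratio
  have h : (0 : ℝ) ≤ k := k.cast_nonneg
  have := Real.exp_pos (-((k : ℝ) + 1))
  gcongr
  linarith

theorem ratio_le_one (k : ℕ) : ratio k ≤ 1 := by
  refine (ratio_le k).trans ?_
  have h : (0 : ℝ) ≤ k := k.cast_nonneg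
  rw [div_le_one (by linarith)]
  linarith

/-- The left side is the price, in units of `f Y`, of one overflowing swap; the right side is the
surplus left by the contraction argument. For `k = 1` the inequality amounts to `exp(-2) ≥ 1/9`,
that is `e ≤ 3`, so `ε = 1/4` leaves little room there. -/
theorem half_le_ratio_slack {k : ℕ} (hk : 1 ≤ k) :
    1 / 2 ≤ ratio k * (k - 1 / 8) + Real.exp (-((k : ℝ) + 1)) := by
  have h : (1 : ℝ) ≤ k := by exact_mod_cast hk
  have hr : ratio k * (k + 1) = 1 - Real.exp (-((k : ℝ) + 1)) := by
    unfold ratio; field_simp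
  have he := Real.exp_pos (-((k : ℝ) + 1))
  -- This is the claim multiplied by `k + 1`, with everything on one side. The exponential is needed
  -- only for `k = 1`.
  have key : 0 ≤ (k : ℝ) / 2 - 5 / 8 + 9 / 8 * Real.exp (-((k : ℝ) + 1)) := by
    rcases hk.eq_or_lt with rfl | hk2
    · have h2 : Real.exp (-(((1 : ℕ) : ℝ) + 1)) = (Real.exp 1 ^ 2)⁻¹ := by
        rw [Real.exp_neg, ← Real.exp_nat_mul]; norm_num
      have h3 : (1 : ℝ) / 9 ≤ (Real.exp 1 ^ 2)⁻¹ := by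
        rw [one_div]
        refine inv_anti₀ (by positivity) ?_
        have := Real.exp_one_lt_three
        nlinarith [Real.exp_pos 1]
      rw [h2]
      norm_num at h3 ⊢
      linarith
    · have : (2 : ℝ) ≤ k := by exact_mod_cast hk2
      linarith
  have hk1 : (0 : ℝ) < k + 1 := by linarith
  refine le_of_mul_le_mul_right ?_ hk1
  have : (ratio k * (k - 1 / 8) + Real.exp (-((k : ℝ) + 1))) * (k + 1) =
      (1 - Real.exp (-((k : ℝ) + 1))) * (k - 1 / 8) + Real.exp (-((k : ℝ) + 1)) * (k + 1) := by
    rw [← hr]; ring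
  rw [this]
  nlinarith

/-! ### The approximation guarantee. -/

namespace Problem

variable {k n : ℕ} (I : Problem k n)

/-- The first two elements of `O` in greedy order. -/
theorem exists_greedy_pair {O : Finset (Fin n)} (hO : 2 ≤ O.card) :
    ∃ Y ⊆ O, Y.card = 2 ∧ ∀ x ∈ O \ Y, I.f (insert x Y) - I.f Y ≤ I.f Y / 2 := by
  have hne : O.Nonempty := Finset.card_pos.1 (by omega)
  obtain ⟨a, ha, hamax⟩ := Finset.exists_max_image O (fun x => I.f {x}) hne
  have hne' : (O.erase a).Nonempty := by
    rw [← Finset.card_pos, Finset.card_erase_of_mem ha]; omega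
  obtain ⟨b, hb, hbmax⟩ := Finset.exists_max_image (O.erase a) (fun x => I.f (insert x {a})) hne'
  rw [Finset.mem_erase] at hb
  refine ⟨{b, a}, ?_, Finset.card_pair hb.1, ?_⟩
  · intro u hu
    rcases Finset.mem_insert.1 hu with rfl | hu
    · exact hb.2
    · rwa [Finset.mem_singleton.1 hu]
  · intro x hx
    simp only [Finset.mem_sdiff, Finset.mem_insert, Finset.mem_singleton, not_or] at hx
    -- The marginal value of `x` over the pair is at most `f {b, a} - f {a}` by the choice of `b`,
    -- and at most `f {a}` by the choice of `a`. Adding the two bounds gives `2 · marginal ≤ f Y`.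
    have h1 := marginal_antitone I.f I.f_mono I.f_submodular
      (show ({a} : Finset (Fin n)) ⊆ {b, a} by simp) x
    have h2 := marginal_antitone I.f I.f_mono I.f_submodular
      (Finset.empty_subset ({b, a} : Finset (Fin n))) x
    have h3 := hbmax x (Finset.mem_erase.2 ⟨hx.2.2, hx.1⟩)
    have h4 := hamax x hx.1
    have h5 := I.f_nonneg ∅
    simp only [insert_empty_eq] at h2
    linarith

/-- At most `n - 2` further elements add at most `f Y / 2` each. This is why the threshold `(n/2) f
Y` can refute only guesses whose runs already beat `O`, or guesses that are not greedy pairs. -/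
theorem value_le_of_greedy_pair {O Y : Finset (Fin n)} (hYO : Y ⊆ O) (hY : Y.card = 2)
    (hg : ∀ x ∈ O \ Y, I.f (insert x Y) - I.f Y ≤ I.f Y / 2) : I.f O ≤ n / 2 * I.f Y := by
  have h1 := sum_marginal_ge I.f I.f_mono I.f_submodular Y (O \ Y)
  rw [Finset.union_sdiff_of_subset hYO] at h1
  have h2 := Finset.sum_le_sum hg
  rw [Finset.sum_const, nsmul_eq_mul] at h2
  have h3 : ((O \ Y).card : ℝ) + 2 ≤ n := by
    have h4 := Finset.card_sdiff_add_card_eq_card hYO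
    have h5 : O.card ≤ n := by simpa using Finset.card_le_univ O
    have : (O \ Y).card + 2 ≤ n := by omega
    exact_mod_cast this
  have h6 := I.f_nonneg Y
  nlinarith

theorem run_feasible {ε : ℝ} {Y S : Finset (Fin n)} (hY : I.Feasible Y)
    (h : Relation.ReflTransGen
      (fun S₁ S₂ => ¬ I.GuessRefuted Y S₁ ∧ I.GreedySwap ε Y S₁ S₂) Y S) :
    I.Feasible S ∧ Y ⊆ S := by
  induction h with
  | refl => exact ⟨hY, le_rfl⟩
  | tail _ hstep ih =>
    obtain ⟨-, x, y, hadm, -, rfl⟩ := hstep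
    exact ⟨hadm.feasible, subset_swapped x ih.2 hadm.2.1⟩

/-- A run from the right guess is good, or it is on schedule: the gap to the target has shrunk
exponentially in the total size of the added elements. -/
theorem run_progress {O Y S : Finset (Fin n)} (hn : 0 < n) (hk : 1 ≤ k) (hO : I.Feasible O)
    (hYO : Y ⊆ O) (hg : ∀ x ∈ O \ Y, I.f (insert x Y) - I.f Y ≤ I.f Y / 2)
    (h : Relation.ReflTransGen
      (fun S₁ S₂ => ¬ I.GuessRefuted Y S₁ ∧ I.GreedySwap (1 / 4) Y S₁ S₂) Y S) :
    let D := I.f O + (k - 1 / 8) * I.f Y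
    let C := I.size (O \ Y)
    let r : ℝ := k + 1
    (¬ I.GuessRefuted Y S → ¬ (∃ x y, I.Admissible (1 / 4) Y S x y) →
      ratio k * I.f O ≤ I.f S) ∧
    (ratio k * I.f O ≤ I.f S ∨
      ∃ t : ℝ, 0 ≤ t ∧ I.size S ≤ I.size Y + t ∧
        D - r * I.f S ≤ Real.exp (-(r * t / C)) * (D - r * I.f Y)) := by
  intro D C r
  have hkr : (1 : ℝ) ≤ k := by exact_mod_cast hk
  have hr : 0 < r := by simp only [r]; linarith
  have hC : 0 ≤ C := I.size_nonneg _
  have hDO : I.f O ≤ D := by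
    have := I.f_nonneg Y
    simp only [D]; nlinarith
  have hsmall : ∀ S, D - r * I.f S ≤ 0 → ratio k * I.f O ≤ I.f S := by
    intro S hS
    calc ratio k * I.f O ≤ 1 / r * I.f O :=
          mul_le_mul_of_nonneg_right (ratio_le k) (I.f_nonneg O)
      _ ≤ 1 / r * D := by gcongr
      _ ≤ 1 / r * (r * I.f S) := by gcongr; linarith
      _ = I.f S := by field_simp
  -- This is `1 - z ≤ exp(-z)` with `z = r c / C`. If `C = 0`, division by zero makes the exponent 0
  -- and `γ ≥ 0` suffices.
  have hexp : ∀ {g c γ : ℝ}, 0 ≤ g → 0 ≤ c → 0 ≤ γ → g * c ≤ C * γ →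
      g - r * γ ≤ Real.exp (-(r * c / C)) * g := by
    intro g c γ hg0 hc hγ hle
    rcases hC.eq_or_lt with hC0 | hC0
    · rw [← hC0]; simp; positivity
    · have h1 := Real.add_one_le_exp (-(r * c / C))
      have h2 : g * c / C ≤ γ := by rw [div_le_iff₀ hC0]; linarith
      have h3 : g * (r * c / C) = r * (g * c / C) := by ring
      nlinarith
  -- If the dense swap overflows the size bound, `S` is good before the swap: compare `S` with the
  -- fictitious result of the swap.
  have hviol : ∀ {S : Finset (Fin n)} {t : ℝ}, I.Feasible S → Y ⊆ S → 0 ≤ t →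
      I.size S ≤ I.size Y + t →
      D - r * I.f S ≤ Real.exp (-(r * t / C)) * (D - r * I.f Y) →
      ¬ D - r * I.f S ≤ 0 →
      (∃ x ∈ O \ S, ∃ y ⊆ S, I.B < I.c x - I.size y + I.size S ∧
        (D - r * I.f S) * I.c x ≤ C * I.gain S x y) →
      ratio k * I.f O ≤ I.f S := by
    rintro S t hSf hYS ht hst hprog hpos ⟨x, hx, y, hyS, hB, hle⟩
    rw [not_le] at hpos
    rw [Finset.mem_sdiff] at hx
    have hxY : x ∈ O \ Y := Finset.mem_sdiff.2 ⟨hx.1, fun h => hx.2 (hYS h)⟩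
    have hcx : 0 < I.c x := by
      have := hSf.2
      have := I.size_nonneg y
      linarith
    have hCx : I.c x ≤ C := Finset.single_le_sum (fun u _ => I.c_nonneg u) hxY
    have hC0 : 0 < C := hcx.trans_le hCx
    have hγ : 0 ≤ I.gain S x y := by
      by_contra! hneg
      have : 0 < (D - r * I.f S) * I.c x := by positivity
      nlinarith
    have h1 := hexp hpos.le hcx.le hγ hle
    have hY0 : 0 ≤ D - r * I.f Y := by
      by_contra! hneg
      have := Real.exp_pos (-(r * t / C))
      nlinarith
    -- The overflow says `c(S) - c(y) + c x > B ≥ c(O)`, while `c(S) ≤ c(Y) + t`.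
    have hCt : C ≤ t + I.c x := by
      have h2 : C = I.size O - I.size Y := I.size_sdiff hYO
      have := hO.2
      have := I.size_nonneg y
      linarith
    have h2 : D - r * (I.f S + I.gain S x y) ≤ Real.exp (-r) * (D - r * I.f Y) := by
      calc D - r * (I.f S + I.gain S x y) = D - r * I.f S - r * I.gain S x y := by ring
        _ ≤ Real.exp (-(r * I.c x / C)) * (D - r * I.f S) := h1
        _ ≤ Real.exp (-(r * I.c x / C)) * (Real.exp (-(r * t / C)) * (D - r * I.f Y)) := by
            gcongr
        _ = Real.exp (-(r * (t + I.c x) / C)) * (D - r * I.f Y) := by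
            rw [← mul_assoc, ← Real.exp_add]; congr 2; ring
        _ ≤ Real.exp (-r) * (D - r * I.f Y) := by
            refine mul_le_mul_of_nonneg_right (Real.exp_le_exp.2 ?_) hY0
            rw [neg_le_neg_iff, le_div_iff₀ hC0]
            gcongr
    -- Forgetting the removal only increases the gain, and the marginal value of `x` over `S` is at
    -- most that over `Y`.
    have h3 : I.gain S x y ≤ I.f Y / 2 := by
      have h4 : I.f (swapped S x y) ≤ I.f (insert x S) := by
        rw [swapped_eq_insert]
        exact I.f_mono _ _ (Finset.insert_subset_insert _ Finset.sdiff_subset)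
      have h5 := marginal_antitone I.f I.f_mono I.f_submodular hYS x
      have h6 := hg x hxY
      simp only [gain]
      linarith
    have hrat : ratio k * r = 1 - Real.exp (-r) := by
      simp only [ratio, r]; field_simp
    have h7 : ratio k * D + Real.exp (-r) * I.f Y ≤ I.f S + I.gain S x y := by
      refine le_of_mul_le_mul_right ?_ hr
      have : (ratio k * D + Real.exp (-r) * I.f Y) * r =
          (1 - Real.exp (-r)) * D + Real.exp (-r) * r * I.f Y := by rw [← hrat]; ring
      rw [this]
      linarith
    have h8 := mul_le_mul_of_nonneg_right (half_le_ratio_slack hk) (I.f_nonneg Y)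
    have h9 : ratio k * D = ratio k * I.f O + ratio k * (k - 1 / 8) * I.f Y := by
      simp only [D]; ring
    simp only [r] at h7
    linarith
  have hlast : ∀ {S : Finset (Fin n)}, I.Feasible S → Y ⊆ S →
      (ratio k * I.f O ≤ I.f S ∨
        ∃ t : ℝ, 0 ≤ t ∧ I.size S ≤ I.size Y + t ∧
          D - r * I.f S ≤ Real.exp (-(r * t / C)) * (D - r * I.f Y)) →
      ¬ I.GuessRefuted Y S → ¬ (∃ x y, I.Admissible (1 / 4) Y S x y) →
      ratio k * I.f O ≤ I.f S := by
    rintro S hSf hYS (hgood | ⟨t, ht, hst, hprog⟩) href hadm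
    · exact hgood
    by_cases hpos : D - r * I.f S ≤ 0
    · exact hsmall S hpos
    rcases I.greedy_step hn hSf.1 hO.1 hYS hYO href with h | h | h
    · exact absurd h hpos
    · exact absurd h.1 hadm
    · exact hviol hSf hYS ht hst hprog hpos h
  have hmain : ratio k * I.f O ≤ I.f S ∨
      ∃ t : ℝ, 0 ≤ t ∧ I.size S ≤ I.size Y + t ∧
        D - r * I.f S ≤ Real.exp (-(r * t / C)) * (D - r * I.f Y) := by
    induction h with
    | refl => exact Or.inr ⟨0, le_rfl, by simp, by simp⟩
    | @tail S₁ S₂ hrun hstep ih =>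
      obtain ⟨href, x, y, hadm, hmax, rfl⟩ := hstep
      obtain ⟨hSf, hYS⟩ := I.run_feasible (hO.mono hYO) hrun
      have hinc : I.f S₁ ≤ I.f (swapped S₁ x y) := by
        have := hadm.gain_pos; unfold gain at this; linarith
      rcases ih with hgood | ⟨t, ht, hst, hprog⟩
      · exact Or.inl (hgood.trans hinc)
      by_cases hpos : D - r * I.f S₁ ≤ 0
      · exact Or.inl ((hsmall _ hpos).trans hinc)
      rcases I.greedy_step hn hSf.1 hO.1 hYS hYO href with h | h | h
      · exact absurd h hpos
      · right
        -- The parameter `t` counts all sizes ever added and never subtracts removals, which is why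
        -- the size of `S` is bounded by, and not equal to, `c(Y) + t`.
        refine ⟨t + I.c x, add_nonneg ht (I.c_nonneg x), ?_, ?_⟩
        · rw [I.size_swapped hadm.1.1 hadm.1.2.1]
          have := I.size_nonneg y
          linarith
        · have h1 := hexp (not_le.1 hpos).le (I.c_nonneg x) hadm.gain_pos.le (h.2 x y hadm hmax)
          have h2 : I.f (swapped S₁ x y) = I.f S₁ + I.gain S₁ x y := by unfold gain; ring
          calc D - r * I.f (swapped S₁ x y) = D - r * I.f S₁ - r * I.gain S₁ x y := by
                rw [h2]; ring
            _ ≤ Real.exp (-(r * I.c x / C)) * (D - r * I.f S₁) := h1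
            _ ≤ Real.exp (-(r * I.c x / C)) * (Real.exp (-(r * t / C)) * (D - r * I.f Y)) := by
                gcongr
            _ = Real.exp (-(r * (t + I.c x) / C)) * (D - r * I.f Y) := by
                rw [← mul_assoc, ← Real.exp_add]; congr 2; ring
      · exact Or.inl ((hviol hSf hYS ht hst hprog hpos h).trans hinc)
  obtain ⟨hSf, hYS⟩ := I.run_feasible (hO.mono hYO) h
  exact ⟨hlast hSf hYS hmain, hmain⟩

theorem output_feasible {ε : ℝ} {S : Finset (Fin n)} (h : I.IsOutput ε S) : I.Feasible S := by
  obtain ⟨R, hR, ⟨Y, hY, rfl⟩, -⟩ := h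
  have := hR Y hY
  unfold GuessResult at this
  split_ifs at this with hc
  · exact (I.run_feasible hY.2 this.1).1
  · rw [this]; exact hY.2

/-- A single guess suffices for the bound: `O` itself if it has fewer than two elements, otherwise
its greedy pair. In the second case the run was either refuted, so it beats `O`, or it stopped for
lack of admissible swaps. -/
theorem output_ratio (hk : 1 ≤ k) {S O : Finset (Fin n)} (h : I.IsOutput (1 / 4) S)
    (hO : I.Feasible O) : ratio k * I.f O ≤ I.f S := by
  obtain ⟨R, hR, -, hmax⟩ := h
  have hle : ratio k * I.f O ≤ I.f O :=
    mul_le_of_le_one_left (I.f_nonneg O) (ratio_le_one k)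
  by_cases hcard : 2 ≤ O.card
  · obtain ⟨Y, hYO, hY2, hg⟩ := I.exists_greedy_pair hcard
    have hn : 0 < n := by
      have : O.card ≤ n := by simpa using Finset.card_le_univ O
      omega
    have hYg : I.IsGuess Y := ⟨hY2.le, hO.mono hYO⟩
    have hrun := hR Y hYg
    rw [GuessResult, if_pos hY2] at hrun
    refine le_trans ?_ (hmax Y hYg)
    by_cases href : I.GuessRefuted Y (R Y)
    · exact hle.trans ((I.value_le_of_greedy_pair hYO hY2 hg).trans href.le)
    · refine (I.run_progress hn hk hO hYO hg hrun.1).1 href ?_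
      rintro ⟨x, y, hxy⟩
      exact (hrun.2.resolve_left href) x y hxy
  · have hOg : I.IsGuess O := ⟨by omega, hO⟩
    have hrun := hR O hOg
    rw [GuessResult, if_neg (by omega)] at hrun
    have := hmax O hOg
    rw [hrun] at this
    exact hle.trans this

end Problem

/-! ### Timed correctness of programs. -/

variable {k n : ℕ}

/-- Started with memory `σ`, the program `p` halts within `t` steps with a memory that
satisfies `Q`. -/
def Reach (I : Problem k n) (p : Program k) (σ : State n) (t : ℕ) (Q : State n → Prop) : Prop :=
  ∃ s τ, s ≤ t ∧ Exec I p σ s τ ∧ Q τ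

namespace Reach

variable {I : Problem k n} {p q : Program k} {σ : State n} {t t₁ t₂ : ℕ} {Q Q' : State n → Prop}

theorem mono (h : Reach I p σ t₁ Q) (ht : t₁ ≤ t) (hQ : ∀ τ, Q τ → Q' τ) : Reach I p σ t Q' := by
  obtain ⟨s, τ, hs, he, hτ⟩ := h
  exact ⟨s, τ, hs.trans ht, he, hQ τ hτ⟩

theorem skip (h : Q σ) (ht : 1 ≤ t) : Reach I .skip σ t Q :=
  ⟨1, σ, ht, .skip σ, h⟩

theorem op {a : Instr} (h : Q (a.apply I σ)) (ht : 1 ≤ t) : Reach I (.op a) σ t Q :=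
  ⟨1, _, ht, .op a σ, h⟩

theorem seq (t₁ t₂ : ℕ) (h : Reach I p σ t₁ fun τ => Reach I q τ t₂ Q) (ht : t₁ + t₂ ≤ t) :
    Reach I (.seq p q) σ t Q := by
  obtain ⟨s, τ, hs, he, s', τ', hs', he', hτ⟩ := h
  exact ⟨s + s', τ', by omega, .seq he he', hτ⟩

theorem ite {b : Test k} (h₁ : b.Holds I σ → Reach I p σ t₁ Q)
    (h₂ : ¬ b.Holds I σ → Reach I q σ t₁ Q) (ht : t₁ + 1 ≤ t) :
    Reach I (.ite b p q) σ t Q := by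
  by_cases hb : b.Holds I σ
  · obtain ⟨s, τ, hs, he, hτ⟩ := h₁ hb
    exact ⟨s + 1, τ, by omega, .ite_true hb he, hτ⟩
  · obtain ⟨s, τ, hs, he, hτ⟩ := h₂ hb
    exact ⟨s + 1, τ, by omega, .ite_false hb he, hτ⟩

/-- A loop whose body decreases the rank `m` in the invariant. -/
theorem loop {b : Test k} {Inv : ℕ → State n → Prop} {t₁ : ℕ}
    (hstep : ∀ m τ, Inv m τ → b.Holds I τ → Reach I p τ t₁ fun τ' => ∃ m' < m, Inv m' τ')
    (m : ℕ) (σ : State n) (h : Inv m σ) :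
    Reach I (.loop b p) σ (m * (t₁ + 1) + 1) fun τ => (∃ m', Inv m' τ) ∧ ¬ b.Holds I τ := by
  induction m using Nat.strong_induction_on generalizing σ with
  | _ m ih =>
    by_cases hb : b.Holds I σ
    · obtain ⟨s, τ, hs, he, m', hm', hτ⟩ := hstep m σ h hb
      obtain ⟨s', τ', hs', he', hτ'⟩ := ih m' hm' τ hτ
      refine ⟨s + s' + 1, τ', ?_, .loop_step hb he he', hτ'⟩
      have : (m' + 1) * (t₁ + 1) ≤ m * (t₁ + 1) := Nat.mul_le_mul_right _ hm'
      have h2 : (m' + 1) * (t₁ + 1) = m' * (t₁ + 1) + (t₁ + 1) := by ring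
      omega
    · exact ⟨1, σ, by omega, .loop_done hb, ⟨m, h⟩, hb⟩

end Reach

/-- Straight-line code. -/
def block : List Instr → Program k
  | [] => .skip
  | a :: l => .seq (.op a) (block l)

theorem Reach.block {I : Problem k n} {l : List Instr} {σ : State n} {t : ℕ} {Q : State n → Prop}
    (h : Q (l.foldl (fun τ a => a.apply I τ) σ)) (ht : l.length + 1 ≤ t) :
    Reach I (block l) σ t Q := by
  induction l generalizing σ t with
  | nil => exact Reach.skip h (by omega)
  | cons a l ih =>
    simp only [List.length_cons] at ht
    exact Reach.seq 1 (l.length + 1) (Reach.op (ih h le_rfl) le_rfl) (by omega)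

/-- Index `i` runs through the numbers below index `1`. -/
def forUpTo (i : ℕ) (p : Program k) : Program k :=
  .seq (.op (.zero i)) (.loop (.idxLt i 1) (.seq p (.op (.succ i))))

/-- The body hands over the invariant as it will hold once the counter has advanced, since the
invariant may refer to the loop register. Each pass pays two extra steps, for the test and the
increment. -/
theorem Reach.forUpTo {I : Problem k n} {i : ℕ} {p : Program k} {σ : State n} {t t₁ : ℕ}
    {Q : State n → Prop} (Inv : ℕ → State n → Prop) (hi : i ≠ 1) (hn : σ.idx 1 = n)
    (h0 : Inv 0 (σ.setIdx i 0))
    (hstep : ∀ m, m < n → ∀ τ, τ.idx i = m → τ.idx 1 = n → Inv m τ →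
      Reach I p τ t₁ fun τ' => τ'.idx i = m ∧ τ'.idx 1 = n ∧ Inv (m + 1) (τ'.setIdx i (m + 1)))
    (hQ : ∀ τ, τ.idx i = n → Inv n τ → Q τ) (ht : n * (t₁ + 2) + 2 ≤ t) :
    Reach I (forUpTo i p) σ t Q := by
  refine Reach.seq 1 (n * (t₁ + 2) + 1) (Reach.op ?_ le_rfl) (by omega)
  -- The rank is the number `n - m` of passes still to come.
  refine (Reach.loop (t₁ := t₁ + 1) (Inv := fun r τ =>
    ∃ m, m + r = n ∧ τ.idx i = m ∧ τ.idx 1 = n ∧ Inv m τ) ?_ n _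
    ⟨0, by simp, by simp [State.setIdx], ?_, h0⟩).mono le_rfl ?_
  · rintro r τ ⟨m, hmr, hm, h1, hinv⟩ hb
    have hb' : m < n := by simpa [Test.Holds, hm, h1] using hb
    refine Reach.seq t₁ 1 ((hstep m hb' τ hm h1 hinv).mono le_rfl ?_) le_rfl
    rintro τ' ⟨hm', h1', hinv'⟩
    refine Reach.op ⟨r - 1, by omega, m + 1, by omega, ?_, ?_, ?_⟩ le_rfl
    · simp [Instr.apply, State.setIdx, hm']
    · simp [Instr.apply, State.setIdx, Function.update_of_ne (Ne.symm hi), h1']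
    · simpa [Instr.apply, hm'] using hinv'
  · simp [State.setIdx, Function.update_of_ne (Ne.symm hi), hn]
  · rintro τ ⟨⟨r, m, hmr, hm, h1, hinv⟩, hb⟩
    have hb' : ¬ m < n := by simpa [Test.Holds, hm, h1] using hb
    obtain rfl : m = n := by omega
    exact hQ τ hm hinv

/-- Run `p` if the set in register `s` is independent in all listed matroids. -/
def ifIndep (s : ℕ) (p : Program k) : List (Fin k) → Program k
  | [] => p
  | j :: l => .ite (.indep j s) (ifIndep s p l) .skip

theorem Reach.ifIndep {I : Problem k n} {s : ℕ} {p : Program k} {σ : State n} {t t₁ : ℕ}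
    {Q : State n → Prop} (h₁ : I.Indep (σ.sets s) → Reach I p σ t₁ Q)
    (h₂ : ¬ I.Indep (σ.sets s) → Q σ) (ht : t₁ + k + 1 ≤ t) :
    Reach I (ifIndep s p (List.finRange k)) σ t Q := by
  suffices ∀ l : List (Fin k), (∀ j, j ∉ l → (I.matroid j).Indep (σ.sets s : Set (Fin n))) →
      Reach I (MatKnap.ifIndep s p l) σ (t₁ + l.length + 1) Q by
    refine (this (List.finRange k) (fun j hj => absurd (List.mem_finRange j) hj)).mono ?_
      (fun _ h => h)
    simpa using ht
  intro l
  induction l with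
  | nil =>
    intro hl
    exact (h₁ fun j => hl j (by simp)).mono (by simp) fun _ h => h
  | cons j l ih =>
    intro hl
    refine Reach.ite (t₁ := t₁ + l.length + 1) (fun hj => ih fun i hi => ?_)
      (fun hj => Reach.skip (h₂ fun hI => hj (hI j)) (by omega)) (by simp)
    by_cases hij : i = j
    · subst hij; exact hj
    · exact hl i (by simp [hij, hi])

/-! ### Programs that evaluate and enumerate swaps. -/

/-- Copy the first `j` index registers of the current removed elements to those of the best swap
found so far. -/
def copyRemoved : ℕ → Program k
  | 0 => .skip
  | j + 1 => .seq (copyRemoved j) (.op (.copy (11 + 2 * j) (10 + 2 * j)))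

/-- Record the current swap as the best one. -/
def recordSwap (k : ℕ) : Program k :=
  .seq (block [.zero 5, .succ 5, .copy 6 4, .move 6 8, .move 7 9]) (copyRemoved k)

/-- Record the current swap if it has greater density than the best one. -/
def compareSwap (k : ℕ) : Program k :=
  .seq (.op (.minus 8 8 4)) (.ite (.idxEq 5 0) (recordSwap k)
    (.seq (block [.times 11 6 9, .times 14 8 7]) (.ite (.realLt 11 14) (recordSwap k) .skip)))

/-- Test whether the current swap increases the value by the required factor. -/
def ifImproves (p : Program k) : Program k :=
  .ite (.idxEq 7 0) p
    (.seq (block [.times 11 0 8, .times 14 1 4]) (.ite (.realLt 11 14) .skip p))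

/-- Evaluate the swap that inserts element `x` into set `2`. -/
def evalSwap (k : ℕ) : Program k :=
  .seq (block [.insert 2 4, .value 8 2, .cost 9 4, .plus 10 9 5])
    (.seq (.ite (.realLt 4 8) (.ite (.realLt 2 10) .skip
        (ifImproves (ifIndep 2 (compareSwap k) (List.finRange k)))) .skip)
      (.op (.erase 2 4)))

/-- Evaluate all swaps that insert `x` and remove at most `j` further elements. -/
def enumSwaps (k : ℕ) : ℕ → Program k
  | 0 => evalSwap k
  | j + 1 => .seq (.op (.copy (10 + 2 * j) 1)) (.seq (enumSwaps k j)
      (forUpTo (10 + 2 * j) (.ite (.mem 2 (10 + 2 * j)) (.ite (.mem 1 (10 + 2 * j)) .skip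
        (.seq (block [.erase 2 (10 + 2 * j), .succ 7, .cost 8 (10 + 2 * j), .minus 5 5 8])
          (.seq (enumSwaps k j)
            (block [.insert 2 (10 + 2 * j), .pred 7, .cost 8 (10 + 2 * j), .plus 5 5 8]))))
        .skip)))

/-! ### Memory invariants of the search. -/

/-- The elements whose numbers are among `g a, ..., g (b - 1)`. -/
noncomputable def listed (n : ℕ) (g : ℕ → ℕ) (a b : ℕ) : Finset (Fin n) :=
  open Classical in Finset.univ.filter fun u => ∃ i, a ≤ i ∧ i < b ∧ g i = u.val

theorem mem_listed {g : ℕ → ℕ} {a b : ℕ} {u : Fin n} :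
    u ∈ listed n g a b ↔ ∃ i, a ≤ i ∧ i < b ∧ g i = u.val := by simp [listed]

theorem listed_congr {g g' : ℕ → ℕ} {a b : ℕ} (h : ∀ i, a ≤ i → i < b → g i = g' i) :
    listed n g a b = listed n g' a b := by
  ext u
  simp only [mem_listed]
  exact exists_congr fun i => and_congr_right fun h1 => and_congr_right fun h2 => by rw [h i h1 h2]

theorem listed_eq_insert {g : ℕ → ℕ} {a b : ℕ} (hab : a < b) (h : g a < n) :
    listed n g a b = insert ⟨g a, h⟩ (listed n g (a + 1) b) := by
  ext u
  simp only [Finset.mem_insert, mem_listed, Fin.ext_iff]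
  constructor
  · rintro ⟨i, h1, h2, h3⟩
    rcases h1.eq_or_lt with rfl | h1
    · exact Or.inl h3.symm
    · exact Or.inr ⟨i, h1, h2, h3⟩
  · rintro (h1 | ⟨i, h1, h2, h3⟩)
    · exact ⟨a, le_rfl, hab, h1.symm⟩
    · exact ⟨i, by omega, h2, h3⟩

/-- A register holding a number that is at least `n` names no element. An unused level of the
enumeration is represented this way. -/
theorem listed_eq_of_le {g : ℕ → ℕ} {a b : ℕ} (h : n ≤ g a) :
    listed n g a b = listed n g (a + 1) b := by
  ext u
  simp only [mem_listed]
  constructor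
  · rintro ⟨i, h1, h2, h3⟩
    rcases h1.eq_or_lt with rfl | h1
    · have := u.2; omega
    · exact ⟨i, h1, h2, h3⟩
  · rintro ⟨i, h1, h2, h3⟩
    exact ⟨i, by omega, h2, h3⟩

/-- The registers that the search for the best swap must not change are the same in `σ` and `τ`;
of the loop variables of the enumeration, those of levels `≥ j`. -/
structure Keep (j : ℕ) (σ τ : State n) : Prop where
  sets : τ.sets = σ.sets
  idx : ∀ i, i < 10 → i ≠ 5 → i ≠ 6 → i ≠ 8 → τ.idx i = σ.idx i
  loops : ∀ i, j ≤ i → τ.idx (10 + 2 * i) = σ.idx (10 + 2 * i)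
  real : ∀ r, r < 6 ∨ r = 12 ∨ r = 13 → τ.real r = σ.real r

theorem Keep.refl (j : ℕ) (σ : State n) : Keep j σ σ :=
  ⟨rfl, fun _ _ _ _ _ => rfl, fun _ _ => rfl, fun _ _ => rfl⟩

theorem Keep.trans {j : ℕ} {σ τ υ : State n} (h₁ : Keep j σ τ) (h₂ : Keep j τ υ) : Keep j σ υ :=
  ⟨h₂.sets.trans h₁.sets, fun i a b c d => (h₂.idx i a b c d).trans (h₁.idx i a b c d),
    fun i hi => (h₂.loops i hi).trans (h₁.loops i hi),
    fun r hr => (h₂.real r hr).trans (h₁.real r hr)⟩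

theorem Keep.mono {j j' : ℕ} {σ τ : State n} (h : Keep j σ τ) (hj : j ≤ j') : Keep j' σ τ :=
  ⟨h.sets, h.idx, fun i hi => h.loops i (hj.trans hi), h.real⟩

/-- The best admissible swap found so far, if there is one, is `b`. -/
def BestIs (I : Problem k n) (Y S : Finset (Fin n)) (σ : State n) :
    Option (Fin n × Finset (Fin n)) → Prop
  | none => σ.idx 5 = 0
  | some (x, y) => I.Admissible (1 / 4) Y S x y ∧ σ.idx 5 = 1 ∧ σ.idx 6 = x ∧
      σ.real 6 = I.gain S x y ∧ σ.real 7 = I.c x ∧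
      y = listed n (fun i => σ.idx (11 + 2 * i)) 0 k

theorem BestIs.congr {I : Problem k n} {Y S : Finset (Fin n)} {σ τ : State n}
    {b : Option (Fin n × Finset (Fin n))} (h : BestIs I Y S σ b) (h5 : τ.idx 5 = σ.idx 5)
    (h6 : τ.idx 6 = σ.idx 6) (hl : ∀ i, τ.idx (11 + 2 * i) = σ.idx (11 + 2 * i))
    (hr6 : τ.real 6 = σ.real 6) (hr7 : τ.real 7 = σ.real 7) : BestIs I Y S τ b := by
  rcases b with _ | ⟨x, y⟩
  · exact h5.trans h
  · obtain ⟨h1, h2, h3, h4, h7, h8⟩ := h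
    refine ⟨h1, h5.trans h2, h6.trans h3, hr6.trans h4, hr7.trans h7, ?_⟩
    rw [h8]
    exact listed_congr fun i _ _ => (hl i).symm

/-- The swap `(x, y)` is inadmissible or no better than `b`. -/
def Covered (I : Problem k n) (Y S : Finset (Fin n)) (b : Option (Fin n × Finset (Fin n)))
    (x : Fin n) (y : Finset (Fin n)) : Prop :=
  I.Admissible (1 / 4) Y S x y → ∃ p, b = some p ∧ I.density S x y ≤ I.density S p.1 p.2

/-- Everything covered by `b` is covered by `b'`. -/
def Refines (I : Problem k n) (Y S : Finset (Fin n)) (b b' : Option (Fin n × Finset (Fin n))) :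
    Prop := ∀ x y, Covered I Y S b x y → Covered I Y S b' x y

/-- The memory during the search for the best swap: the element `x` is to be inserted into `S`
and the elements of `y` have been removed. -/
structure Ctx (I : Problem k n) (Y S : Finset (Fin n)) (x : Fin n) (y : Finset (Fin n))
    (σ : State n) : Prop where
  sub : y ⊆ S
  disj : Disjoint y Y
  not_mem : x ∉ S
  guess : σ.sets 1 = Y
  current : σ.sets 2 = S \ y
  idx_zero : σ.idx 0 = 0
  idx_size : σ.idx 1 = n
  idx_elem : σ.idx 4 = x
  idx_removed : σ.idx 7 = y.card
  real_scale : σ.real 0 = 4 * (n : ℝ) ^ 2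
  real_scale_succ : σ.real 1 = 4 * (n : ℝ) ^ 2 + 1
  real_bound : σ.real 2 = I.B
  real_value : σ.real 4 = I.f S
  real_size : σ.real 5 = I.size (S \ y)

theorem Ctx.keep {I : Problem k n} {Y S y : Finset (Fin n)} {x : Fin n} {j : ℕ} {σ τ : State n}
    (h : Ctx I Y S x y σ) (hk : Keep j σ τ) : Ctx I Y S x y τ where
  sub := h.sub
  disj := h.disj
  not_mem := h.not_mem
  guess := by rw [hk.sets, h.guess]
  current := by rw [hk.sets, h.current]
  idx_zero := by rw [hk.idx 0 (by omega) (by omega) (by omega) (by omega), h.idx_zero]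
  idx_size := by rw [hk.idx 1 (by omega) (by omega) (by omega) (by omega), h.idx_size]
  idx_elem := by rw [hk.idx 4 (by omega) (by omega) (by omega) (by omega), h.idx_elem]
  idx_removed := by rw [hk.idx 7 (by omega) (by omega) (by omega) (by omega), h.idx_removed]
  real_scale := by rw [hk.real 0 (by omega), h.real_scale]
  real_scale_succ := by rw [hk.real 1 (by omega), h.real_scale_succ]
  real_bound := by rw [hk.real 2 (by omega), h.real_bound]
  real_value := by rw [hk.real 4 (by omega), h.real_value]
  real_size := by rw [hk.real 5 (by omega), h.real_size]

/-! ### Correctness of the search for a best swap. -/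

theorem reach_copyRemoved (I : Problem k n) (σ : State n) (j : ℕ) :
    Reach I (copyRemoved j) σ (j + 1) fun τ =>
      τ.sets = σ.sets ∧ τ.real = σ.real ∧ (∀ i, i < 11 → τ.idx i = σ.idx i) ∧
      (∀ i, τ.idx (10 + 2 * i) = σ.idx (10 + 2 * i)) ∧
      ∀ i, i < j → τ.idx (11 + 2 * i) = σ.idx (10 + 2 * i) := by
  induction j with
  | zero => exact Reach.skip (by simp) le_rfl
  | succ j ih =>
    refine Reach.seq (j + 1) 1 (ih.mono le_rfl ?_) le_rfl
    rintro τ ⟨h1, h2, h3, h4, h5⟩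
    refine Reach.op ⟨h1, h2, ?_, ?_, ?_⟩ le_rfl
    · intro i hi
      simp [Instr.apply, State.setIdx, Function.update_apply, h3 i hi]
      omega
    · intro i
      simp [Instr.apply, State.setIdx, Function.update_apply, h4 i]
      omega
    · intro i hi
      by_cases hij : i = j
      · subst hij
        simp [Instr.apply, State.setIdx, h4]
      · simp [Instr.apply, State.setIdx, h4, hij, h5 i (by omega)]

/-- The result of evaluating the swap `(x, y)`. -/
def Evaluated (I : Problem k n) (Y S : Finset (Fin n)) (x : Fin n) (y : Finset (Fin n))
    (b : Option (Fin n × Finset (Fin n))) (σ τ : State n) : Prop :=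
  Keep 0 σ τ ∧ ∃ b', BestIs I Y S τ b' ∧ Refines I Y S b b' ∧ Covered I Y S b' x y

theorem reach_recordSwap (I : Problem k n) {Y S y : Finset (Fin n)} {x : Fin n} {σ : State n}
    (hadm : I.Admissible (1 / 4) Y S x y) (h4 : σ.idx 4 = x)
    (h8 : σ.real 8 = I.gain S x y) (h9 : σ.real 9 = I.c x)
    (hy : y = listed n (fun i => σ.idx (10 + 2 * i)) 0 k) :
    Reach I (recordSwap k) σ (k + 7) fun τ => Keep 0 σ τ ∧ BestIs I Y S τ (some (x, y)) := by
  refine Reach.seq 6 (k + 1) (Reach.block ?_ (by simp)) (by omega)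
  refine (reach_copyRemoved I _ k).mono le_rfl ?_
  rintro τ ⟨h1, h2, h3, h5, h6⟩
  simp only [List.foldl, Instr.apply, State.setIdx, State.setReal] at h1 h2 h3 h5 h6
  refine ⟨⟨h1, ?_, ?_, ?_⟩, hadm, ?_, ?_, ?_, ?_, ?_⟩
  · intro i hi hi5 hi6 _
    rw [h3 i (by omega)]
    simp [hi5, hi6]
  · intro i _
    rw [h5 i]
    simp [show 10 + 2 * i ≠ 5 by omega, show 10 + 2 * i ≠ 6 by omega]
  · intro r hr
    rw [h2]
    have : r ≠ 6 ∧ r ≠ 7 := by omega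
    simp [this]
  · rw [h3 5 (by omega)]; simp
  · rw [h3 6 (by omega)]; simp [h4]
  · rw [h2]; simp [h8]
  · rw [h2]; simp [h9]
  · rw [hy]
    refine listed_congr fun i _ hi => ?_
    rw [h6 i hi]
    simp [show 10 + 2 * i ≠ 5 by omega, show 10 + 2 * i ≠ 6 by omega]

theorem Keep.evaluated {I : Problem k n} {Y S y : Finset (Fin n)} {x : Fin n}
    {b : Option (Fin n × Finset (Fin n))} {σ τ : State n} (h : Keep 0 σ τ)
    (hb : BestIs I Y S τ b) (hc : Covered I Y S b x y) : Evaluated I Y S x y b σ τ :=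
  ⟨h, b, hb, fun _ _ h => h, hc⟩

/-- The record is overwritten only by a strictly denser swap, so by transitivity whatever the old
record covered stays covered. If it is kept, the failed comparison says that it covers the new swap.
-/
theorem reach_compareSwap (I : Problem k n) {Y S y : Finset (Fin n)} {x : Fin n}
    {b : Option (Fin n × Finset (Fin n))} {σ : State n}
    (hb : BestIs I Y S σ b) (h0 : σ.idx 0 = 0)
    (hadm : I.Admissible (1 / 4) Y S x y) (h4 : σ.idx 4 = x) (hr4 : σ.real 4 = I.f S)
    (h8 : σ.real 8 = I.f (Problem.swapped S x y)) (h9 : σ.real 9 = I.c x)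
    (hy : y = listed n (fun i => σ.idx (10 + 2 * i)) 0 k) :
    Reach I (compareSwap k) σ (k + 13) (Evaluated I Y S x y b σ) := by
  have hg := hadm.gain_pos
  refine Reach.seq 1 (k + 12) (Reach.op ?_ le_rfl) (by omega)
  simp only [Instr.apply, State.setReal, h8, hr4]
  refine Reach.ite (t₁ := k + 11) (fun h => ?_) (fun h => ?_) (by omega)
  · refine (reach_recordSwap I hadm ?_ ?_ ?_ ?_).mono (by omega) ?_
    · exact h4
    · simp [Problem.gain]
    · simp [h9]
    · exact hy
    · rintro τ ⟨hk, hbest⟩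
      refine ⟨⟨hk.sets, hk.idx, hk.loops, ?_⟩, _, hbest, ?_, fun _ => ⟨_, rfl, le_rfl⟩⟩
      · intro r hr
        rw [hk.real r hr]
        simp [show r ≠ 8 by omega]
      · intro x' y' hc hadm'
        obtain ⟨p, rfl, -⟩ := hc hadm'
        have h5 : σ.idx 5 = 1 := hb.2.1
        simp [Test.Holds, h0, h5] at h
  · obtain _ | ⟨bx, bY⟩ := b
    · exact absurd ((hb : σ.idx 5 = 0).trans h0.symm) h
    obtain ⟨ba, b5, b6, br6, br7, bl⟩ := hb
    refine Reach.seq 3 (k + 8) (Reach.block ?_ (by simp)) (by omega)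
    simp only [List.foldl, Instr.apply, State.setReal]
    refine Reach.ite (t₁ := k + 7) (fun h' => ?_) (fun h' => ?_) (by omega)
    · refine (reach_recordSwap I hadm ?_ ?_ ?_ ?_).mono (by omega) ?_
      · exact h4
      · simp [Problem.gain]
      · simp [h9]
      · exact hy
      · rintro τ ⟨hk, hbest⟩
        refine ⟨⟨hk.sets, hk.idx, hk.loops, ?_⟩, _, hbest, ?_, fun _ => ⟨_, rfl, le_rfl⟩⟩
        · intro r hr
          rw [hk.real r hr]
          simp [show r ≠ 8 by omega, show r ≠ 11 by omega, show r ≠ 14 by omega]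
        · intro x' y' hc hadm'
          obtain ⟨p, hp, hle⟩ := hc hadm'
          cases hp
          refine ⟨_, rfl, hle.trans ((I.density_le_iff ba.gain_pos hg).2 ?_)⟩
          simp [Test.Holds, br6, br7, h9] at h'
          exact h'.le
    · refine Reach.skip (Keep.evaluated ⟨rfl, fun _ _ _ _ _ => rfl, fun _ _ => rfl, ?_⟩
        (b := some (bx, bY)) ⟨ba, b5, b6, ?_, ?_, bl⟩ ?_) (by omega)
      · intro r hr
        simp [show r ≠ 8 by omega, show r ≠ 11 by omega, show r ≠ 14 by omega]
      · simp [br6]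
      · simp [br7]
      · intro _
        refine ⟨_, rfl, (I.density_le_iff hg ba.gain_pos).2 ?_⟩
        simp [Test.Holds, br6, br7, h9] at h'
        exact h'

/-- Clearing the denominator leaves the two constants `4n²` and `4n² + 1`, which the program keeps
in real registers. -/
theorem improves_iff {a b : ℝ} (hn : 0 < n) :
    (1 + 1 / 4 / (n : ℝ) ^ 2) * a ≤ b ↔ (4 * (n : ℝ) ^ 2 + 1) * a ≤ 4 * (n : ℝ) ^ 2 * b := by
  have h : (0 : ℝ) < 4 * (n : ℝ) ^ 2 := by positivity
  have h2 : (4 * (n : ℝ) ^ 2 + 1) * a = 4 * (n : ℝ) ^ 2 * ((1 + 1 / 4 / (n : ℝ) ^ 2) * a) := by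
    field_simp
  rw [h2, mul_le_mul_iff_right₀ h]

/-- Each test corresponds to one clause of admissibility. When one fails, the swap is covered
vacuously and the record can stay; the independence oracles are asked last. The final erasure
restores the current set. -/
theorem reach_evalSwap (I : Problem k n) {Y S y : Finset (Fin n)} {x : Fin n}
    {b : Option (Fin n × Finset (Fin n))} {σ : State n} (h : Ctx I Y S x y σ)
    (hb : BestIs I Y S σ b) (hcard : y.card ≤ k)
    (hy : y = listed n (fun i => σ.idx (10 + 2 * i)) 0 k) :
    Reach I (evalSwap k) σ (2 * k + 30) (Evaluated I Y S x y b σ) := by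
  have hn : 0 < n := x.pos
  refine Reach.seq 5 (2 * k + 25) (Reach.block ?_ (by simp)) (by omega)
  have hxlt : σ.idx 4 < n := by rw [h.idx_elem]; exact x.2
  have hxe : (⟨σ.idx 4, hxlt⟩ : Fin n) = x := Fin.ext h.idx_elem
  have hxy : x ∉ S \ y := fun hm => h.not_mem (Finset.mem_sdiff.1 hm).1
  let σ' : State n := ⟨σ.idx, Function.update (Function.update (Function.update σ.real 8
    (I.f (Problem.swapped S x y))) 9 (I.c x)) 10 (I.c x + I.size (S \ y)),
    Function.update σ.sets 2 (Problem.swapped S x y)⟩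
  have hσ' : List.foldl (fun τ (a : Instr) => a.apply I τ) σ
      [.insert 2 4, .value 8 2, .cost 9 4, .plus 10 9 5] = σ' := by
    simp [List.foldl, Instr.apply, State.setSet, State.setReal, hxlt, hxe, h.current,
      h.real_size, σ', Problem.swapped_eq_insert]
  rw [hσ']
  have hback : ∀ τ : State n, Evaluated I Y S x y b σ' τ →
      Evaluated I Y S x y b σ ((Instr.erase 2 4).apply I τ) := by
    rintro τ ⟨hk, b', hb', hr, hc⟩
    have e4 : τ.idx 4 = x := by
      rw [hk.idx 4 (by omega) (by omega) (by omega) (by omega)]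
      exact h.idx_elem
    have hst : (Instr.erase 2 4).apply I τ = ⟨τ.idx, τ.real, σ.sets⟩ := by
      simp only [Instr.apply, e4, x.2, dif_pos, State.setSet, hk.sets, σ']
      congr 1
      simp only [Function.update_self, Function.update_idem, Fin.eta]
      rw [Problem.swapped_eq_insert, Finset.erase_insert hxy, ← h.current,
        Function.update_eq_self]
    rw [hst]
    refine ⟨⟨rfl, hk.idx, hk.loops, fun r hr => ?_⟩, b', hb'.congr rfl rfl (fun _ => rfl) rfl rfl,
      hr, hc⟩
    rw [hk.real r hr]
    simp [σ', show r ≠ 8 by omega, show r ≠ 9 by omega, show r ≠ 10 by omega]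
  have hb' : BestIs I Y S σ' b :=
    hb.congr rfl rfl (fun _ => rfl) (by simp [σ']) (by simp [σ'])
  have hsame : ¬ I.Admissible (1 / 4) Y S x y → Evaluated I Y S x y b σ' σ' := fun hna =>
    (Keep.refl 0 σ').evaluated hb' fun hadm => absurd hadm hna
  have r4 : σ'.real 4 = I.f S := by simp [σ', h.real_value]
  have r8 : σ'.real 8 = I.f (Problem.swapped S x y) := by simp [σ']
  have r10 : σ'.real 10 = I.c x + I.size (S \ y) := by simp [σ']
  have r2 : σ'.real 2 = I.B := by simp [σ', h.real_bound]
  refine Reach.seq (2 * k + 24) 1 (Reach.mono (Q := Evaluated I Y S x y b σ') ?_ le_rfl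
    fun τ hτ => Reach.op (hback τ hτ) le_rfl) (by omega)
  refine Reach.ite (t₁ := 2 * k + 23) (fun hpos => ?_) (fun hpos => ?_) (by omega)
  swap
  · refine Reach.skip (hsame fun hadm => hpos ?_) (by omega)
    have := hadm.2.2.1
    simp only [Test.Holds, r4, r8]
    linarith
  simp only [Test.Holds, r4, r8] at hpos
  refine Reach.ite (t₁ := 2 * k + 22) (fun hB => ?_) (fun hB => ?_) (by omega)
  · refine Reach.skip (hsame fun hadm => ?_) (by omega)
    have := hadm.2.2.2.1
    simp only [Test.Holds, r2, r10, I.size_sdiff h.sub] at hB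
    linarith
  simp only [Test.Holds, r2, r10, I.size_sdiff h.sub, not_lt] at hB
  have hind : ∀ σ'' : State n, σ''.idx = σ'.idx → σ''.sets = σ'.sets →
      (∀ r, r < 11 ∨ r = 12 ∨ r = 13 → σ''.real r = σ'.real r) →
      (y ≠ ∅ → (1 + 1 / 4 / (n : ℝ) ^ 2) * I.f S ≤ I.f (Problem.swapped S x y)) →
      Reach I (ifIndep 2 (compareSwap k) (List.finRange k)) σ'' (2 * k + 14)
        (Evaluated I Y S x y b σ') := by
    intro σ'' hidx hsets hreal himp
    have hkeep : Keep 0 σ' σ'' := ⟨hsets, fun i _ _ _ _ => by rw [hidx], fun i _ => by rw [hidx],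
      fun r hr => hreal r (by omega)⟩
    have hb'' : BestIs I Y S σ'' b := hb'.congr (by rw [hidx]) (by rw [hidx])
      (fun i => by rw [hidx]) (hreal 6 (by omega)) (hreal 7 (by omega))
    have hset : σ''.sets 2 = Problem.swapped S x y := by rw [hsets]; simp [σ']
    refine Reach.ifIndep (t₁ := k + 13) (fun hi => ?_) (fun hi => ?_) (by omega)
    · rw [hset] at hi
      have hadm : I.Admissible (1 / 4) Y S x y :=
        ⟨⟨h.not_mem, h.sub, hcard, hi⟩, h.disj, by linarith, by linarith, himp⟩
      refine (reach_compareSwap I hb'' ?_ hadm ?_ ?_ ?_ ?_ ?_).mono le_rfl ?_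
      · rw [hidx]; exact h.idx_zero
      · rw [hidx]; exact h.idx_elem
      · rw [hreal 4 (by omega), r4]
      · rw [hreal 8 (by omega), r8]
      · rw [hreal 9 (by omega)]; simp [σ']
      · rw [hidx]; exact hy
      · rintro τ ⟨h1, h2⟩
        exact ⟨hkeep.trans h1, h2⟩
    · rw [hset] at hi
      exact hkeep.evaluated hb'' fun hadm => absurd hadm.1.2.2.2 hi
  refine Reach.ite (t₁ := 2 * k + 20) (fun he => ?_) (fun he => ?_) (by omega)
  · refine (hind σ' rfl rfl (fun _ _ => rfl) fun hne => ?_).mono (by omega) fun _ h => h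
    exfalso
    have h7 : σ.idx 7 = σ.idx 0 := he
    rw [h.idx_removed, h.idx_zero, Finset.card_eq_zero] at h7
    exact hne h7
  · refine Reach.seq 3 (2 * k + 16) (Reach.block ?_ (by simp)) (by omega)
    simp only [List.foldl, Instr.apply, State.setReal]
    have hreal : ∀ r, r < 11 ∨ r = 12 ∨ r = 13 → (Function.update (Function.update σ'.real 11
        (σ'.real 0 * σ'.real 8)) 14 (σ'.real 1 * σ'.real 4)) r = σ'.real r := by
      intro r hr
      simp [show r ≠ 11 by omega, show r ≠ 14 by omega]
    have r0 : σ'.real 0 = 4 * (n : ℝ) ^ 2 := by simp [σ', h.real_scale]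
    have r1 : σ'.real 1 = 4 * (n : ℝ) ^ 2 + 1 := by simp [σ', h.real_scale_succ]
    refine Reach.ite (t₁ := 2 * k + 15) (fun hlt => ?_) (fun hlt => ?_) (by omega)
    · refine Reach.skip (Keep.evaluated ⟨rfl, fun _ _ _ _ _ => rfl, fun _ _ => rfl, fun r hr =>
        hreal r (by omega)⟩ (hb'.congr rfl rfl (fun _ => rfl) (hreal 6 (by omega))
        (hreal 7 (by omega))) fun hadm => ?_) (by omega)
      exfalso
      have hne : y ≠ ∅ := by
        rintro rfl
        -- The counter in index 7 replaces a test for emptiness: it is 0 exactly if nothing is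
        -- removed.
        exact he (h.idx_removed.trans (by simp [σ', h.idx_zero]))
      have := (improves_iff hn).1 (hadm.2.2.2.2 hne)
      simp [Test.Holds, r0, r1, r4, r8] at hlt
      linarith
    · refine (hind _ ?_ ?_ ?_ fun _ => ?_).mono (by omega) fun _ h => h
      · rfl
      · rfl
      · exact hreal
      rw [improves_iff hn]
      simpa [Test.Holds, r0, r1, r4, r8] using hlt

theorem BestIs.keep_setIdx {I : Problem k n} {Y S : Finset (Fin n)} {σ : State n}
    {b : Option (Fin n × Finset (Fin n))} (h : BestIs I Y S σ b) (j v : ℕ) :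
    BestIs I Y S (σ.setIdx (10 + 2 * j) v) b := by
  refine h.congr ?_ ?_ (fun i => ?_) rfl rfl
  · simp [State.setIdx, show 5 ≠ 10 + 2 * j by omega]
  · simp [State.setIdx, show 6 ≠ 10 + 2 * j by omega]
  · simp [State.setIdx, show 11 + 2 * i ≠ 10 + 2 * j by omega]

theorem keep_setIdx (σ : State n) (j v : ℕ) : Keep (j + 1) σ (σ.setIdx (10 + 2 * j) v) := by
  refine ⟨rfl, fun i hi _ _ _ => ?_, fun i hi => ?_, fun _ _ => rfl⟩
  · simp [State.setIdx, show i ≠ 10 + 2 * j by omega]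
  · simp [State.setIdx, show i ≠ j by omega]

theorem Ctx.listed_insert {I : Problem k n} {Y S y : Finset (Fin n)} {x u : Fin n} {σ : State n}
    (h : Ctx I Y S x y σ) (hu : u ∈ S \ y) (huY : u ∉ Y) {j : ℕ} (hj : σ.idx (10 + 2 * j) = u) :
    let l : List Instr := [.erase 2 (10 + 2 * j), .succ 7, .cost 8 (10 + 2 * j), .minus 5 5 8]
    let σ' := l.foldl (fun τ a => a.apply I τ) σ
    σ' = ⟨Function.update σ.idx 7 (y.card + 1),
      Function.update (Function.update σ.real 8 (I.c u)) 5 (I.size (S \ y) - I.c u),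
      Function.update σ.sets 2 (S \ insert u y)⟩ ∧ Ctx I Y S x (insert u y) σ' := by
  intro l σ'
  have huS := Finset.mem_sdiff.1 hu
  have hset : (S \ y).erase u = S \ insert u y := by ext v; simp; tauto
  have hσ' : σ' = ⟨Function.update σ.idx 7 (y.card + 1),
      Function.update (Function.update σ.real 8 (I.c u)) 5 (I.size (S \ y) - I.c u),
      Function.update σ.sets 2 (S \ insert u y)⟩ := by
    simp [σ', l, List.foldl, Instr.apply, State.setSet, State.setReal, State.setIdx, hj,
      h.current, h.real_size, h.idx_removed, hset, show 10 + 2 * j ≠ 7 by omega]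
  have hsub : insert u y ⊆ S := Finset.insert_subset huS.1 h.sub
  have hsize : I.size (S \ y) - I.c u = I.size (S \ insert u y) := by
    rw [I.size_sdiff h.sub, I.size_sdiff hsub, I.size_insert huS.2]
    ring
  refine ⟨hσ', ?_⟩
  rw [hσ']
  exact {
    sub := hsub
    disj := Finset.disjoint_insert_left.2 ⟨huY, h.disj⟩
    not_mem := h.not_mem
    guess := by simp [h.guess]
    current := by simp
    idx_zero := by simp [h.idx_zero]
    idx_size := by simp [h.idx_size]
    idx_elem := by simp [h.idx_elem]
    idx_removed := by simp [Finset.card_insert_of_notMem huS.2]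
    real_scale := by simp [h.real_scale]
    real_scale_succ := by simp [h.real_scale_succ]
    real_bound := by simp [h.real_bound]
    real_value := by simp [h.real_value]
    real_size := by simp [hsize] }

/-- The result of the enumeration of the swaps that insert `x`, remove `y` and at most `j` further
elements. -/
def Enumerated (I : Problem k n) (Y S : Finset (Fin n)) (x : Fin n) (y : Finset (Fin n))
    (j : ℕ) (b : Option (Fin n × Finset (Fin n))) : Prop :=
  ∀ z ⊆ S \ y, Disjoint z Y → z.card ≤ j → Covered I Y S b x (y ∪ z)

theorem Enumerated.refines {I : Problem k n} {Y S y : Finset (Fin n)} {x : Fin n} {j : ℕ}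
    {b b' : Option (Fin n × Finset (Fin n))} (h : Enumerated I Y S x y j b)
    (hr : Refines I Y S b b') : Enumerated I Y S x y j b' :=
  fun z h1 h2 h3 => hr _ _ (h z h1 h2 h3)

/-- A removal of `j + 1` elements is some first element `u` followed by `j` others. Any choice of
`u` will do, so the enumeration may meet the same set in several orders. -/
theorem Enumerated.succ {I : Problem k n} {Y S y : Finset (Fin n)} {x : Fin n} {j : ℕ}
    {b : Option (Fin n × Finset (Fin n))} (h : Enumerated I Y S x y j b)
    (h' : ∀ u ∈ S \ y, u ∉ Y → Enumerated I Y S x (insert u y) j b) :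
    Enumerated I Y S x y (j + 1) b := by
  intro z hz hzY hcard
  by_cases hc : z.card ≤ j
  · exact h z hz hzY hc
  obtain ⟨u, hu⟩ : z.Nonempty := Finset.card_pos.1 (by omega)
  have h1 := h' u (hz hu) (Finset.disjoint_left.1 hzY hu) (z.erase u) ?_ ?_ ?_
  · have h2 : insert u y ∪ z.erase u = y ∪ z := by
      rw [Finset.insert_union, ← Finset.union_insert, Finset.insert_erase hu]
    rwa [h2] at h1
  · intro v hv
    have hv' := Finset.mem_erase.1 hv
    have hvz := Finset.mem_sdiff.1 (hz hv'.2)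
    simp [hvz.1, hvz.2, hv'.1]
  · exact hzY.mono_left (Finset.erase_subset _ _)
  · rw [Finset.card_erase_of_mem hu]; omega

/-- A bound on the running time of the enumeration. -/
def enumTime (k n : ℕ) : ℕ → ℕ
  | 0 => 2 * k + 30
  | j + 1 => enumTime k n j + n * (enumTime k n j + 20) + 10

/-- Induction on the number `j` of free levels. The levels from `j` upwards hold the elements of `y`
and must survive, so that a recorded swap can be copied at the bottom; `y` varies because the
recursive calls enlarge it. -/
theorem reach_enumSwaps (I : Problem k n) {Y S : Finset (Fin n)} {x : Fin n} (j : ℕ) :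
    ∀ (y : Finset (Fin n)) (σ : State n) (b : Option (Fin n × Finset (Fin n))),
      Ctx I Y S x y σ → BestIs I Y S σ b → y.card + j ≤ k →
      y = listed n (fun i => σ.idx (10 + 2 * i)) j k →
      Reach I (enumSwaps k j) σ (enumTime k n j) fun τ => Keep j σ τ ∧
        ∃ b', BestIs I Y S τ b' ∧ Refines I Y S b b' ∧ Enumerated I Y S x y j b' := by
  induction j with
  | zero =>
    intro y σ b h hb hcard hy
    refine (reach_evalSwap I h hb hcard hy).mono le_rfl ?_
    rintro τ ⟨hk, b', hb', hr, hc⟩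
    refine ⟨hk, b', hb', hr, fun z _ _ hz => ?_⟩
    rw [Nat.le_zero, Finset.card_eq_zero] at hz
    simpa [hz] using hc
  | succ j ih =>
    intro y σ b h hb hcard hy
    refine Reach.seq 1 (enumTime k n j + n * (enumTime k n j + 20) + 9) (Reach.op ?_ le_rfl)
      (by simp only [enumTime]; omega)
    change Reach I _ (σ.setIdx (10 + 2 * j) (σ.idx 1)) _ _
    rw [h.idx_size]
    have hk0 := keep_setIdx σ j n
    -- Level `j` was set to `n`, which names no element, so the first recursive call removes nothing
    -- at this level.
    have hfirst : y = listed n (fun i => (σ.setIdx (10 + 2 * j) n).idx (10 + 2 * i)) j k := by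
      rw [listed_eq_of_le (by simp [State.setIdx]), hy]
      exact listed_congr fun i hi _ => (hk0.loops i hi).symm
    refine Reach.seq (enumTime k n j) (n * (enumTime k n j + 20) + 9)
      ((ih y _ b (h.keep hk0) (hb.keep_setIdx j n) (by omega) hfirst).mono le_rfl ?_) (by omega)
    rintro σ₁ ⟨hk1, b₁, hb1, hr1, he1⟩
    have hkeep1 : Keep (j + 1) σ σ₁ := hk0.trans (hk1.mono (by omega))
    refine Reach.forUpTo (t₁ := enumTime k n j + 16) (fun m τ => Keep (j + 1) σ τ ∧
      ∃ b', BestIs I Y S τ b' ∧ Refines I Y S b b' ∧ Enumerated I Y S x y j b' ∧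
        ∀ u ∈ S \ y, u ∉ Y → u.val < m → Enumerated I Y S x (insert u y) j b')
      (by omega) ((h.keep hkeep1).idx_size) ?_ ?_ ?_ (by nlinarith)
    · exact ⟨hkeep1.trans (keep_setIdx _ _ _), b₁, hb1.keep_setIdx _ _, hr1, he1,
        fun u _ _ hu => absurd hu (by omega)⟩
    · rintro m hm τ hτm hτ1 ⟨hkτ, b', hb', hr', he', hu'⟩
      have hctx := h.keep hkτ
      have hskip : (∀ u ∈ S \ y, u ∉ Y → u.val ≠ m) → Reach I .skip τ (enumTime k n j + 14)
          fun τ' => τ'.idx (10 + 2 * j) = m ∧ τ'.idx 1 = n ∧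
            (Keep (j + 1) σ (τ'.setIdx (10 + 2 * j) (m + 1)) ∧
            ∃ b', BestIs I Y S (τ'.setIdx (10 + 2 * j) (m + 1)) b' ∧ Refines I Y S b b' ∧
              Enumerated I Y S x y j b' ∧ ∀ u ∈ S \ y, u ∉ Y → u.val < m + 1 →
                Enumerated I Y S x (insert u y) j b') := by
        intro hne
        refine Reach.skip ⟨hτm, hτ1, hkτ.trans (keep_setIdx _ _ _), b', hb'.keep_setIdx _ _,
          hr', he', fun u h1 h2 h3 => hu' u h1 h2 ?_⟩ (by omega)
        have := hne u h1 h2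
        omega
      refine Reach.ite (t₁ := enumTime k n j + 15) (fun hmem => ?_) (fun hmem => ?_) (by omega)
      swap
      · refine (hskip fun u h1 _ h3 => hmem ?_).mono (by omega) fun _ h => h
        subst h3
        exact ⟨by rw [hτm]; exact u.2, by simpa [hτm, hctx.current] using h1⟩
      refine Reach.ite (t₁ := enumTime k n j + 14) (fun hmemY => ?_) (fun hmemY => ?_) (by omega)
      · refine hskip fun u _ h2 h3 => h2 ?_
        obtain ⟨h4, h5⟩ := hmemY
        subst h3
        simpa [hτm, hctx.guess] using h5
      let u : Fin n := ⟨m, hm⟩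
      have hidx : τ.idx (10 + 2 * j) = u := hτm
      have hu : u ∈ S \ y := by
        obtain ⟨h4, h5⟩ := hmem
        simpa only [hτm, hctx.current] using h5
      have huY : u ∉ Y := fun hY => hmemY ⟨by rw [hτm]; exact hm, by
        simpa only [hτm, hctx.guess] using hY⟩
      obtain ⟨hσ', hctx'⟩ := hctx.listed_insert hu huY hidx
      refine Reach.seq 5 (enumTime k n j + 9) (Reach.block ?_ (by simp)) (by omega)
      revert hσ' hctx'
      generalize List.foldl _ τ _ = τ₁
      intro hτ₁ hctx'
      have hb₁ : BestIs I Y S τ₁ b' := by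
        rw [hτ₁]
        exact hb'.congr (by simp) (by simp)
          (fun i => by simp [show 11 + 2 * i ≠ 7 by omega]) (by simp) (by simp)
      have hlist : insert u y = listed n (fun i => τ₁.idx (10 + 2 * i)) j k := by
        have h7 : ∀ i, τ₁.idx (10 + 2 * i) = τ.idx (10 + 2 * i) := fun i => by
          rw [hτ₁]; simp [show 10 + 2 * i ≠ 7 by omega]
        rw [listed_eq_insert (g := fun i => τ₁.idx (10 + 2 * i)) (by omega)
          (show τ₁.idx (10 + 2 * j) < n by rw [h7, hidx]; exact u.2)]
        congr 1
        · exact Fin.ext (by simp only [h7, hidx])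
        · rw [hy]
          exact listed_congr fun i hi _ => by rw [h7, hkτ.loops i hi]
      have hcard' : (insert u y).card = y.card + 1 :=
        Finset.card_insert_of_notMem (Finset.mem_sdiff.1 hu).2
      refine Reach.seq (enumTime k n j) 5
        ((ih (insert u y) τ₁ b' hctx' hb₁ (by omega) hlist).mono le_rfl ?_) (by omega)
      rintro τ₂ ⟨hk2, b₂, hb2, hr2, he2⟩
      have hctx2 := hctx'.keep hk2
      refine Reach.block ?_ (by simp)
      have e1 : τ₂.idx (10 + 2 * j) = u := by
        rw [hk2.loops j le_rfl, hτ₁]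
        simp [show 10 + 2 * j ≠ 7 by omega, hidx]
      have hset : insert u (S \ insert u y) = S \ y := by
        ext v
        by_cases hv : v = u
        · subst hv; simpa using hu
        · simp [hv]
      have hsize : I.size (S \ insert u y) + I.c u = I.size (S \ y) := by
        rw [I.size_sdiff hctx'.sub, I.size_sdiff h.sub, I.size_insert (Finset.mem_sdiff.1 hu).2]
        ring
      have hfin : List.foldl (fun τ (a : Instr) => a.apply I τ) τ₂ [.insert 2 (10 + 2 * j),
          .pred 7, .cost 8 (10 + 2 * j), .plus 5 5 8] =
          ⟨Function.update τ₂.idx 7 y.card,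
            Function.update (Function.update τ₂.real 8 (I.c u)) 5 (I.size (S \ y)), τ.sets⟩ := by
        simp [List.foldl, Instr.apply, State.setSet, State.setReal, State.setIdx, e1,
          hctx2.current, hctx2.real_size, hctx2.idx_removed, hset, hsize, hcard',
          show 10 + 2 * j ≠ 7 by omega]
        rw [hk2.sets, hτ₁, Function.update_idem, ← hctx.current, Function.update_eq_self]
      rw [hfin]
      -- After the recursive call, reinserting `u` and undoing the counter and the size restores the
      -- memory exactly where it matters.
      have hkfin : Keep (j + 1) τ ⟨Function.update τ₂.idx 7 y.card,
            Function.update (Function.update τ₂.real 8 (I.c u)) 5 (I.size (S \ y)), τ.sets⟩ := by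
        refine ⟨rfl, fun i hi h5 h6 h8 => ?_, fun i hi => ?_, fun r hr => ?_⟩
        · by_cases h7 : i = 7
          · subst h7; simp [hctx.idx_removed]
          · simp only [Function.update_of_ne h7]
            rw [hk2.idx i hi h5 h6 h8, hτ₁]
            simp [h7]
        · simp only [Function.update_of_ne (show 10 + 2 * i ≠ 7 by omega)]
          rw [hk2.loops i (by omega), hτ₁]
          simp [show 10 + 2 * i ≠ 7 by omega]
        · by_cases h5 : r = 5
          · subst h5; simp [hctx.real_size]
          · simp only [Function.update_of_ne h5, Function.update_of_ne (show r ≠ 8 by omega)]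
            rw [hk2.real r hr, hτ₁]
            simp [h5, show r ≠ 8 by omega]
      refine ⟨?_, ?_, hkτ.trans (hkfin.trans (keep_setIdx _ _ _)), b₂, ?_, ?_, ?_, ?_⟩
      · simp [show 10 + 2 * j ≠ 7 by omega, e1, u]
      · simpa using hctx2.idx_size
      · refine BestIs.keep_setIdx ?_ _ _
        exact hb2.congr (by simp) (by simp)
          (fun i => by simp [show 11 + 2 * i ≠ 7 by omega]) (by simp) (by simp)
      · exact fun x' y' hc => hr2 _ _ (hr' _ _ hc)
      · exact he'.refines hr2
      · intro w hw hwY hwm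
        rcases Nat.lt_succ_iff_lt_or_eq.1 hwm with hlt | heq
        · exact (hu' w hw hwY hlt).refines hr2
        · obtain rfl : w = u := Fin.ext heq
          exact he2
    · rintro τ - ⟨hkτ, b', hb', hr', he', hu'⟩
      exact ⟨hkτ, b', hb', hr', he'.succ fun u h1 h2 => hu' u h1 h2 u.2⟩

/-! ### One round, and the run from a guess. -/

/-- Compute the size of set `2` into real `5`. -/
def sumSize (k : ℕ) : Program k :=
  .seq (.op (.lit 5 0)) (forUpTo 8 (.ite (.mem 2 8) (block [.cost 9 8, .plus 5 5 9]) .skip))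

/-- Search all swaps of set `2` for a best one. -/
def findBest (k : ℕ) : Program k :=
  .seq (.op (.zero 5)) (forUpTo 4 (.ite (.mem 2 4) .skip (enumSwaps k k)))

/-- Remove the first `j` elements recorded for the best swap. -/
def removeBest : ℕ → Program k
  | 0 => .skip
  | j + 1 => .seq (removeBest j) (.op (.erase 2 (11 + 2 * j)))

/-- One round of the run from a guess: test whether the guess is refuted, and perform a greedy
swap; the flag in index `9` is cleared at the end of the run. -/
def runRound (k : ℕ) : Program k :=
  .seq (block [.value 4 2, .plus 8 4 4]) (.ite (.realLt 3 8) (.op (.zero 9))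
    (.seq (sumSize k) (.seq (findBest k) (.ite (.idxEq 5 0) (.op (.zero 9))
      (.seq (removeBest k) (.op (.insert 2 6)))))))

/-- The run from a guess. -/
def runGuess (k : ℕ) : Program k :=
  .seq (block [.zero 9, .succ 9]) (.loop (.idxLt 0 9) (runRound k))

/-- The registers that a run from a guess must not change are the same in `σ` and `τ`. -/
structure Frame (σ τ : State n) : Prop where
  output : τ.sets 0 = σ.sets 0
  guess : τ.sets 1 = σ.sets 1
  idx : ∀ i, i < 4 ∨ i = 7 → τ.idx i = σ.idx i
  real : ∀ r, r < 4 ∨ r = 12 ∨ r = 13 → τ.real r = σ.real r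

theorem Frame.refl (σ : State n) : Frame σ σ := ⟨rfl, rfl, fun _ _ => rfl, fun _ _ => rfl⟩

theorem Frame.trans {σ τ υ : State n} (h₁ : Frame σ τ) (h₂ : Frame τ υ) : Frame σ υ :=
  ⟨h₂.output.trans h₁.output, h₂.guess.trans h₁.guess,
    fun i hi => (h₂.idx i hi).trans (h₁.idx i hi),
    fun r hr => (h₂.real r hr).trans (h₁.real r hr)⟩

theorem Keep.frame {j : ℕ} {σ τ : State n} (h : Keep j σ τ) : Frame σ τ :=
  ⟨by rw [h.sets], by rw [h.sets], fun i hi => h.idx i (by omega) (by omega) (by omega) (by omega),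
    fun r hr => h.real r (by omega)⟩

/-- The constants in the memory during the run from the guess `Y`. -/
structure Base (I : Problem k n) (Y : Finset (Fin n)) (σ : State n) : Prop where
  guess : σ.sets 1 = Y
  idx_zero : σ.idx 0 = 0
  idx_size : σ.idx 1 = n
  idx_removed : σ.idx 7 = 0
  real_scale : σ.real 0 = 4 * (n : ℝ) ^ 2
  real_scale_succ : σ.real 1 = 4 * (n : ℝ) ^ 2 + 1
  real_bound : σ.real 2 = I.B
  real_refute : σ.real 3 = n * I.f Y

theorem Base.frame {I : Problem k n} {Y : Finset (Fin n)} {σ τ : State n} (h : Base I Y σ)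
    (hf : Frame σ τ) : Base I Y τ where
  guess := by rw [hf.guess, h.guess]
  idx_zero := by rw [hf.idx 0 (by omega), h.idx_zero]
  idx_size := by rw [hf.idx 1 (by omega), h.idx_size]
  idx_removed := by rw [hf.idx 7 (by omega), h.idx_removed]
  real_scale := by rw [hf.real 0 (by omega), h.real_scale]
  real_scale_succ := by rw [hf.real 1 (by omega), h.real_scale_succ]
  real_bound := by rw [hf.real 2 (by omega), h.real_bound]
  real_refute := by rw [hf.real 3 (by omega), h.real_refute]

theorem reach_sumSize (I : Problem k n) {σ : State n} (h1 : σ.idx 1 = n) :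
    Reach I (sumSize k) σ (n * 6 + 3) fun τ => τ.sets = σ.sets ∧
      (∀ i, i ≠ 8 → τ.idx i = σ.idx i) ∧ (∀ r, r ≠ 5 → r ≠ 9 → τ.real r = σ.real r) ∧
      τ.real 5 = I.size (σ.sets 2) := by
  refine Reach.seq 1 (n * 6 + 2) (Reach.op ?_ le_rfl) (by omega)
  refine Reach.forUpTo (t₁ := 4) (fun m τ => τ.sets = σ.sets ∧
    (∀ i, i ≠ 8 → τ.idx i = σ.idx i) ∧ (∀ r, r ≠ 5 → r ≠ 9 → τ.real r = σ.real r) ∧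
      τ.real 5 = I.size ((σ.sets 2).filter fun u => u.val < m)) (by omega) h1 ?_ ?_ ?_ le_rfl
  · refine ⟨rfl, fun i hi => ?_, fun r h5 _ => ?_, ?_⟩
    · simp [State.setIdx, Instr.apply, State.setReal, hi]
    · simp [State.setIdx, Instr.apply, State.setReal, h5]
    · simp [State.setIdx, Instr.apply, State.setReal, Problem.size]
  · rintro m hm τ hτm hτ1 ⟨hs, hi, hr, h5⟩
    let u : Fin n := ⟨m, hm⟩
    refine Reach.ite (t₁ := 3) (fun hmem => ?_) (fun hmem => ?_) le_rfl
    · obtain ⟨h3, h4⟩ := hmem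
      simp only [hτm, hs] at h4
      have hfil : (σ.sets 2).filter (fun v => v.val < m + 1) =
          insert u ((σ.sets 2).filter fun v => v.val < m) := by
        ext v
        simp only [Finset.mem_filter, Finset.mem_insert, u, Fin.ext_iff]
        constructor
        · rintro ⟨ha, hb⟩; by_cases v.val = m
          · left; assumption
          · exact Or.inr ⟨ha, by omega⟩
        · rintro (ha | ⟨ha, hb⟩)
          · obtain rfl : v = u := Fin.ext ha
            exact ⟨h4, by simp [u]⟩
          · exact ⟨ha, by omega⟩
      refine Reach.block ?_ (by simp)
      simp only [List.foldl, Instr.apply, State.setReal, hτm, hm, dif_pos]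
      refine ⟨trivial, hτ1, hs, fun i h8 => ?_, fun r ha hb => ?_, ?_⟩
      · simp [State.setIdx, h8, hi i h8]
      · simp [State.setIdx, ha, hb, hr r ha hb]
      · rw [hfil, I.size_insert (by simp [u])]
        simp [State.setIdx, h5, u]
        exact add_comm _ _
    · have hfil : (σ.sets 2).filter (fun v => v.val < m + 1) =
          (σ.sets 2).filter fun v => v.val < m := by
        refine Finset.filter_congr fun v hv => ?_
        have : v.val ≠ m := by
          rintro rfl
          exact hmem ⟨by rw [hτm]; exact v.2, by simpa [hτm, hs] using hv⟩
        omega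
      refine Reach.skip ⟨hτm, hτ1, hs, fun i h8 => ?_, hr, ?_⟩ (by omega)
      · simp [State.setIdx, h8, hi i h8]
      · rw [hfil]; exact h5
  · rintro τ - ⟨hs, hi, hr, h5⟩
    refine ⟨hs, hi, hr, ?_⟩
    rw [h5]
    congr 1
    exact Finset.filter_true_of_mem fun u _ => u.2

/-- An admissible swap inserts some `x ∉ S` and removes at most `k` elements avoiding `Y`, so
enumerating to depth `k` from the empty removal, for each `x`, misses none. -/
theorem reach_findBest (I : Problem k n) {Y S : Finset (Fin n)} {σ : State n} (h : Base I Y σ)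
    (h2 : σ.sets 2 = S) (hr4 : σ.real 4 = I.f S) (hr5 : σ.real 5 = I.size S) :
    Reach I (findBest k) σ (n * (enumTime k n k + 3) + 3) fun τ => Frame σ τ ∧ τ.sets 2 = S ∧
      τ.idx 9 = σ.idx 9 ∧ ∃ b, BestIs I Y S τ b ∧ ∀ x y, Covered I Y S b x y := by
  refine Reach.seq 1 (n * (enumTime k n k + 3) + 2) (Reach.op ?_ le_rfl) (by omega)
  refine Reach.forUpTo (t₁ := enumTime k n k + 1) (fun m τ => Frame σ τ ∧ τ.sets 2 = S ∧
    τ.idx 9 = σ.idx 9 ∧ τ.real 4 = I.f S ∧ τ.real 5 = I.size S ∧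
    ∃ b, BestIs I Y S τ b ∧ ∀ x : Fin n, x.val < m → ∀ y, Covered I Y S b x y) (by omega) ?_ ?_ ?_ ?_
    le_rfl
  · simpa [Instr.apply, State.setIdx] using h.idx_size
  · refine ⟨⟨rfl, rfl, fun i hi => ?_, fun r hr => rfl⟩, h2, ?_, hr4, hr5, none, ?_, ?_⟩
    · simp [State.setIdx, Instr.apply, show i ≠ 4 by omega, show i ≠ 5 by omega]
    · simp [State.setIdx, Instr.apply]
    · simp [BestIs, State.setIdx, Instr.apply]
    · intro x hx; omega
  · rintro m hm τ hτm hτ1 ⟨hf, h2', h9, h4, h5, b, hb, hc⟩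
    have hbase := h.frame hf
    let x : Fin n := ⟨m, hm⟩
    have hlast : ∀ b', (∀ x : Fin n, x.val < m → ∀ y, Covered I Y S b' x y) →
        (∀ y, Covered I Y S b' x y) → ∀ z : Fin n, z.val < m + 1 → ∀ y, Covered I Y S b' z y := by
      intro b' h1 h3 z hz
      rcases Nat.lt_succ_iff_lt_or_eq.1 hz with hlt | heq
      · exact h1 z hlt
      · obtain rfl : z = x := Fin.ext heq
        exact h3
    have hset : ∀ τ' : State n, Frame τ' (τ'.setIdx 4 (m + 1)) := fun τ' =>
      ⟨rfl, rfl, fun i hi => by simp [State.setIdx, show i ≠ 4 by omega], fun _ _ => rfl⟩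
    have hbset : ∀ (τ' : State n) b', BestIs I Y S τ' b' →
        BestIs I Y S (τ'.setIdx 4 (m + 1)) b' := fun τ' b' hb' =>
      hb'.congr (by simp [State.setIdx]) (by simp [State.setIdx])
        (fun i => by simp [State.setIdx, show 11 + 2 * i ≠ 4 by omega]) rfl rfl
    refine Reach.ite (t₁ := enumTime k n k) (fun hmem => ?_) (fun hmem => ?_) le_rfl
    · have hpos : 1 ≤ enumTime k n k := by
        cases k <;> simp only [enumTime] <;> omega
      refine Reach.skip ⟨hτm, hτ1, hf.trans (hset τ), h2', ?_, h4, h5, b, hbset _ _ hb,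
        hlast b hc fun y hadm => ?_⟩ hpos
      · simp [State.setIdx, h9]
      · obtain ⟨h6, h7⟩ := hmem
        exact absurd (by simpa only [hτm, h2'] using h7) hadm.1.1
    · have hx : x ∉ S := fun hxS => hmem ⟨by rw [hτm]; exact hm, by
        simpa only [hτm, h2'] using hxS⟩
      have hctx : Ctx I Y S x ∅ τ := {
        sub := Finset.empty_subset _
        disj := Finset.disjoint_empty_left _
        not_mem := hx
        guess := hbase.guess
        current := by simp [h2']
        idx_zero := hbase.idx_zero
        idx_size := hbase.idx_size
        idx_elem := hτm
        idx_removed := by simp [hbase.idx_removed]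
        real_scale := hbase.real_scale
        real_scale_succ := hbase.real_scale_succ
        real_bound := hbase.real_bound
        real_value := h4
        real_size := by simp [h5] }
      refine (reach_enumSwaps I k ∅ τ b hctx hb (by simp) ?_).mono le_rfl ?_
      · ext u
        simp only [Finset.notMem_empty, mem_listed, false_iff]
        rintro ⟨i, h6, h7, -⟩
        omega
      · rintro τ' ⟨hk, b', hb', hr', he'⟩
        refine ⟨?_, ?_, hf.trans (hk.frame.trans (hset τ')), ?_, ?_, ?_, ?_, b', hbset _ _ hb',
          hlast b' (fun z hz y => hr' _ _ (hc z hz y)) fun y hadm => ?_⟩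
        · rw [hk.idx 4 (by omega) (by omega) (by omega) (by omega), hτm]
        · rw [hk.idx 1 (by omega) (by omega) (by omega) (by omega), hτ1]
        · change τ'.sets 2 = S
          rw [hk.sets, h2']
        · rw [← h9, ← hk.idx 9 (by omega) (by omega) (by omega) (by omega)]
          simp [State.setIdx]
        · change τ'.real 4 = _
          rw [hk.real 4 (by omega), h4]
        · change τ'.real 5 = _
          rw [hk.real 5 (by omega), h5]
        · have := he' y (by simpa using hadm.1.2.1) hadm.2.1 hadm.1.2.2.1
          rw [Finset.empty_union] at this
          exact this hadm
  · rintro τ - ⟨hf, h2', h9, -, -, b, hb, hc⟩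
    exact ⟨hf, h2', h9, b, hb, fun x => hc x x.2⟩

theorem reach_removeBest (I : Problem k n) (σ : State n) (j : ℕ) :
    Reach I (removeBest j) σ (j + 1) fun τ =>
      τ = σ.setSet 2 (σ.sets 2 \ listed n (fun i => σ.idx (11 + 2 * i)) 0 j) := by
  induction j with
  | zero =>
    refine Reach.skip ?_ le_rfl
    have : listed n (fun i => σ.idx (11 + 2 * i)) 0 0 = ∅ := by
      ext u; simp [mem_listed]
    rw [this, Finset.sdiff_empty]
    simp [State.setSet]
  | succ j ih =>
    refine Reach.seq (j + 1) 1 (ih.mono le_rfl ?_) le_rfl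
    rintro τ rfl
    refine Reach.op ?_ le_rfl
    by_cases hj : σ.idx (11 + 2 * j) < n
    · simp only [Instr.apply, State.setSet, hj, dif_pos, Function.update_self,
        Function.update_idem]
      congr 2
      ext u
      simp only [Finset.mem_erase, Finset.mem_sdiff, mem_listed, Fin.ext_iff, ne_eq]
      constructor
      · rintro ⟨h1, h2, h3⟩
        refine ⟨h2, ?_⟩
        rintro ⟨i, -, h4, h5⟩
        by_cases hij : i = j
        · subst hij; exact h1 h5.symm
        · exact h3 ⟨i, by omega, by omega, h5⟩
      · rintro ⟨h2, h3⟩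
        exact ⟨fun h => h3 ⟨j, by omega, by omega, h.symm⟩, h2,
          fun ⟨i, h4, h5, h6⟩ => h3 ⟨i, h4, by omega, h6⟩⟩
    · have hl : listed n (fun i => σ.idx (11 + 2 * i)) 0 j =
          listed n (fun i => σ.idx (11 + 2 * i)) 0 (j + 1) := ?_
      · simp [Instr.apply, State.setSet, hj, hl]
      ext u
      simp only [mem_listed]
      constructor
      · rintro ⟨i, h4, h5, h6⟩
        exact ⟨i, h4, by omega, h6⟩
      · rintro ⟨i, h4, h5, h6⟩
        refine ⟨i, h4, ?_, h6⟩
        have : i ≠ j := by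
          rintro rfl
          exact hj (h6 ▸ u.2)
        omega

/-- A bound on the running time of one round. -/
def roundTime (k n : ℕ) : ℕ := n * (enumTime k n k + 9) + k + 20

/-- Refutation is tested as `n f Y < f S + f S`, which avoids halving. An empty record after the
search certifies that no swap is admissible, and otherwise the record has maximum density. -/
theorem reach_runRound (I : Problem k n) {Y S : Finset (Fin n)} {σ : State n} (h : Base I Y σ)
    (h2 : σ.sets 2 = S) (h9 : σ.idx 9 = 1) :
    Reach I (runRound k) σ (roundTime k n) fun τ => Frame σ τ ∧
      ((τ.idx 9 = 0 ∧ τ.sets 2 = S ∧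
        (I.GuessRefuted Y S ∨ ∀ x y, ¬ I.Admissible (1 / 4) Y S x y)) ∨
      (τ.idx 9 = 1 ∧ ¬ I.GuessRefuted Y S ∧ I.GreedySwap (1 / 4) Y S (τ.sets 2))) := by
  refine Reach.seq 3 (n * (enumTime k n k + 9) + k + 17) (Reach.block ?_ (by simp))
    (by simp only [roundTime]; omega)
  have hσ' : List.foldl (fun τ (a : Instr) => a.apply I τ) σ [.value 4 2, .plus 8 4 4] =
      ⟨σ.idx, Function.update (Function.update σ.real 4 (I.f S)) 8 (I.f S + I.f S), σ.sets⟩ := by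
    simp [List.foldl, Instr.apply, State.setReal, h2]
  rw [hσ']
  generalize hdef : (⟨σ.idx, Function.update (Function.update σ.real 4 (I.f S)) 8
    (I.f S + I.f S), σ.sets⟩ : State n) = σ'
  have hf : Frame σ σ' := by
    rw [← hdef]
    refine ⟨rfl, rfl, fun _ _ => rfl, fun r hr => ?_⟩
    simp [show r ≠ 4 by omega, show r ≠ 8 by omega]
  have hb := h.frame hf
  have h2' : σ'.sets 2 = S := by rw [← hdef]; exact h2
  have h9' : σ'.idx 9 = 1 := by rw [← hdef]; exact h9
  have h4' : σ'.real 4 = I.f S := by rw [← hdef]; simp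
  have h8' : σ'.real 8 = I.f S + I.f S := by rw [← hdef]; simp
  have hhalt : ∀ τ : State n, Frame τ ((Instr.zero 9).apply I τ) := fun τ =>
    ⟨rfl, rfl, fun i hi => by simp [Instr.apply, State.setIdx, show i ≠ 9 by omega],
      fun _ _ => rfl⟩
  refine Reach.ite (t₁ := n * (enumTime k n k + 9) + k + 16) (fun href => ?_) (fun href => ?_)
    (by omega)
  · refine Reach.op ⟨hf.trans (hhalt σ'), Or.inl ⟨?_, h2', Or.inl ?_⟩⟩ (by omega)
    · simp [Instr.apply, State.setIdx]
    · simp only [Test.Holds, hb.real_refute, h8'] at href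
      unfold Problem.GuessRefuted
      linarith
  have hnref : ¬ I.GuessRefuted Y S := by
    simp only [Test.Holds, hb.real_refute, h8'] at href
    unfold Problem.GuessRefuted
    linarith
  refine Reach.seq (n * 6 + 3) (n * (enumTime k n k + 3) + k + 13)
    ((reach_sumSize I hb.idx_size).mono le_rfl ?_) (by nlinarith)
  rintro τ ⟨hs, hi, hr, h5⟩
  have hfτ : Frame σ' τ := ⟨by rw [hs], by rw [hs], fun i h => hi i (by omega),
    fun r h => hr r (by omega) (by omega)⟩
  refine Reach.seq (n * (enumTime k n k + 3) + 3) (k + 10)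
    ((reach_findBest I (hb.frame hfτ) (by rw [hs, h2']) (by rw [hr 4 (by omega) (by omega), h4'])
      (by rw [h5, h2'])).mono le_rfl ?_) (by omega)
  rintro υ ⟨hfυ, hυ2, hυ9, b, hbest, hcov⟩
  have hfall : Frame σ υ := hf.trans (hfτ.trans hfυ)
  have hbυ := h.frame hfall
  rw [hi 9 (by omega), h9'] at hυ9
  refine Reach.ite (t₁ := k + 9) (fun h0 => ?_) (fun h0 => ?_) (by omega)
  · refine Reach.op ⟨hfall.trans (hhalt υ), Or.inl ⟨?_, hυ2, Or.inr fun x y hadm => ?_⟩⟩ (by omega)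
    · simp [Instr.apply, State.setIdx]
    · obtain ⟨p, rfl, -⟩ := hcov x y hadm
      have h5' : υ.idx 5 = 1 := hbest.2.1
      simp [Test.Holds, hbυ.idx_zero, h5'] at h0
  · obtain _ | ⟨x, y⟩ := b
    · exact absurd ((hbest : υ.idx 5 = 0).trans hbυ.idx_zero.symm) h0
    obtain ⟨hadm, -, h6, -, -, hy⟩ := hbest
    refine Reach.seq (k + 1) 1 ((reach_removeBest I υ k).mono le_rfl ?_) (by omega)
    rintro υ' rfl
    refine Reach.op ?_ le_rfl
    have hfin : (Instr.insert 2 6).apply I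
        (υ.setSet 2 (υ.sets 2 \ listed n (fun i => υ.idx (11 + 2 * i)) 0 k)) =
        υ.setSet 2 (Problem.swapped S x y) := by
      rw [← hy, hυ2, Problem.swapped_eq_insert]
      simp [Instr.apply, State.setSet, h6]
    rw [hfin]
    refine ⟨hfall.trans ⟨?_, ?_, fun _ _ => rfl, fun _ _ => rfl⟩, Or.inr ⟨hυ9, hnref, x, y, hadm,
      fun x' y' hadm' => ?_, ?_⟩⟩
    · simp [State.setSet]
    · simp [State.setSet]
    · obtain ⟨p, hp, hle⟩ := hcov x' y' hadm'
      cases hp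
      exact hle
    · simp [State.setSet]

/-! ### The number of swaps in a run. -/

namespace Problem

variable (I : Problem k n)

/-- `S` is reached from `Y` by `s` greedy swaps without refutation of the guess. -/
inductive Trace (Y : Finset (Fin n)) : ℕ → Finset (Fin n) → Prop
  | zero : Trace Y 0 Y
  | succ {s S S'} : Trace Y s S → ¬ I.GuessRefuted Y S → I.GreedySwap (1 / 4) Y S S' →
      Trace Y (s + 1) S'

variable {I}

theorem Trace.run {Y S : Finset (Fin n)} {s : ℕ} (h : I.Trace Y s S) :
    Relation.ReflTransGen
      (fun S₁ S₂ => ¬ I.GuessRefuted Y S₁ ∧ I.GreedySwap (1 / 4) Y S₁ S₂) Y S := by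
  induction h with
  | zero => exact .refl
  | succ _ h1 h2 ih => exact ih.tail ⟨h1, h2⟩

/-- Here `a` counts the pure insertions and `b` the swaps with removals. An insertion raises the
cardinality by one, any other swap lowers it by less than `k`; only the latter are guaranteed to
multiply the value. The positivity clause serves the case `f Y = 0`, where multiplicative growth
says nothing. -/
theorem Trace.counts {Y S : Finset (Fin n)} {s : ℕ} (h : I.Trace Y s S) :
    (0 < s → 0 < I.f S) ∧ ∃ a b, s = a + b ∧ a ≤ S.card + k * b ∧
      (1 + 1 / 4 / (n : ℝ) ^ 2) ^ b * I.f Y ≤ I.f S := by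
  induction h with
  | zero => exact ⟨by simp, 0, 0, by simp⟩
  | @succ s S S' _ _ hstep ih =>
    obtain ⟨-, a, b, hs, ha, hb⟩ := ih
    obtain ⟨x, y, hadm, -, rfl⟩ := hstep
    have hg : I.f S < I.f (swapped S x y) := by
      have := hadm.2.2.1; linarith
    have hcard : (swapped S x y).card + y.card = S.card + 1 := by
      rw [swapped_eq_insert, Finset.card_insert_of_notMem (by simp [hadm.1.1])]
      have := Finset.card_sdiff_add_card_eq_card hadm.1.2.1
      omega
    refine ⟨fun _ => (I.f_nonneg S).trans_lt hg, ?_⟩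
    by_cases hy : y = ∅
    · refine ⟨a + 1, b, by omega, ?_, hb.trans hg.le⟩
      rw [hy, Finset.card_empty] at hcard
      rw [hy]
      omega
    · refine ⟨a, b + 1, by omega, ?_, ?_⟩
      · have := hadm.1.2.2.1
        rw [mul_add]
        omega
      · calc (1 + 1 / 4 / (n : ℝ) ^ 2) ^ (b + 1) * I.f Y
            = (1 + 1 / 4 / (n : ℝ) ^ 2) * ((1 + 1 / 4 / (n : ℝ) ^ 2) ^ b * I.f Y) := by ring
          _ ≤ (1 + 1 / 4 / (n : ℝ) ^ 2) * I.f S := by gcongr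
          _ ≤ _ := hadm.2.2.2.2 hy

end Problem

/-- A bound on the number of greedy swaps from one guess. -/
def maxSwaps (k n : ℕ) : ℕ := n + (k + 1) * (4 * n ^ 2 * (Nat.log 2 n + 1)) + 1

/-- By Bernoulli's inequality every `4n²` factors double the value, and `log₂ n + 1` doublings
exceed `n`. -/
theorem lt_growth_pow (hn : 0 < n) :
    (n : ℝ) < (1 + 1 / 4 / (n : ℝ) ^ 2) ^ (4 * n ^ 2 * (Nat.log 2 n + 1)) := by
  have h1 : (2 : ℝ) ≤ (1 + 1 / 4 / (n : ℝ) ^ 2) ^ (4 * n ^ 2) := by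
    have hpos : (0 : ℝ) ≤ 1 / 4 / (n : ℝ) ^ 2 := by positivity
    have h2 := one_add_mul_le_pow (by linarith : (-2 : ℝ) ≤ 1 / 4 / (n : ℝ) ^ 2) (4 * n ^ 2)
    refine le_trans (le_of_eq ?_) h2
    push_cast
    field_simp
    norm_num
  have h3 : (n : ℝ) < 2 ^ (Nat.log 2 n + 1) := by
    exact_mod_cast Nat.lt_pow_succ_log_self (by omega) n
  rw [pow_mul]
  exact h3.trans_le (by gcongr)

/-- The bounds are applied to the set before the last swap, which is known to be unrefuted; that
swap accounts for the final `+ 1` in `maxSwaps`. -/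
theorem Problem.Trace.length_le {I : Problem k n} {Y S : Finset (Fin n)} {s : ℕ} (hn : 0 < n)
    (h : I.Trace Y s S) : s ≤ maxSwaps k n := by
  cases h with
  | zero => simp [maxSwaps]
  | @succ s S' _ htr href hstep =>
    obtain ⟨hpos, a, b, hs, ha, hb⟩ := htr.counts
    have hle : I.f S' ≤ n / 2 * I.f Y := not_lt.1 href
    -- If `f Y = 0`, an unrefuted set has value 0, so no swap can have preceded it.
    rcases (I.f_nonneg Y).eq_or_lt with hY | hY
    · rw [← hY, mul_zero] at hle
      have : s = 0 := by
        by_contra hne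
        exact absurd (hpos (by omega)) (not_lt.2 hle)
      simp only [maxSwaps]; omega
    · have hbL : b ≤ 4 * n ^ 2 * (Nat.log 2 n + 1) := by
        by_contra! hlt
        have h1 : (n : ℝ) < (1 + 1 / 4 / (n : ℝ) ^ 2) ^ b := by
          refine (lt_growth_pow hn).trans_le (pow_le_pow_right₀ ?_ hlt.le)
          have : (0 : ℝ) ≤ 1 / 4 / (n : ℝ) ^ 2 := by positivity
          linarith
        have h2 : (n : ℝ) * I.f Y < n / 2 * I.f Y :=
          (mul_lt_mul_of_pos_right h1 hY).trans_le (hb.trans hle)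
        have h3 : (0 : ℝ) < n := by exact_mod_cast hn
        nlinarith
      have hcard : S'.card ≤ n := by simpa using Finset.card_le_univ S'
      have h4 : k * b + b ≤ (k + 1) * (4 * n ^ 2 * (Nat.log 2 n + 1)) := by
        rw [← Nat.succ_mul]
        exact Nat.mul_le_mul_left _ hbL
      simp only [maxSwaps]; omega

/-- A bound on the running time of the run from a guess. -/
def runTime (k n : ℕ) : ℕ := (maxSwaps k n + 1) * (roundTime k n + 1) + 4

theorem reach_runGuess (I : Problem k n) {Y : Finset (Fin n)} {σ : State n} (hn : 0 < n)
    (h : Base I Y σ) (h2 : σ.sets 2 = Y) :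
    Reach I (runGuess k) σ (runTime k n) fun τ =>
      Frame σ τ ∧ I.GreedyRun (1 / 4) Y (τ.sets 2) := by
  refine Reach.seq 3 ((maxSwaps k n + 1) * (roundTime k n + 1) + 1) (Reach.block ?_ (by simp))
    (by simp only [runTime]; omega)
  have hσ' : List.foldl (fun τ (a : Instr) => a.apply I τ) σ [.zero 9, .succ 9] =
      σ.setIdx 9 1 := by
    simp [List.foldl, Instr.apply, State.setIdx]
  rw [hσ']
  -- While the flag is set, the rank is `maxSwaps k n + 1` minus the number of swaps made. It is
  -- positive by `length_le`, which leaves room for the last round, the one that only clears the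
  -- flag.
  refine (Reach.loop (t₁ := roundTime k n) (Inv := fun r τ => Frame σ τ ∧
    ((τ.idx 9 = 0 ∧ I.GreedyRun (1 / 4) Y (τ.sets 2)) ∨
      (τ.idx 9 = 1 ∧ ∃ s, I.Trace Y s (τ.sets 2) ∧ s + r = maxSwaps k n + 1))) ?_
    (maxSwaps k n + 1) (σ.setIdx 9 1) ⟨⟨rfl, rfl, ?_, fun _ _ => rfl⟩, Or.inr ⟨?_, 0, ?_, ?_⟩⟩).mono le_rfl ?_
  · rintro r τ ⟨hf, h9⟩ hb
    have hbτ := h.frame hf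
    rcases h9 with ⟨h9, -⟩ | ⟨h9, s, htr, hs⟩
    · simp [Test.Holds, hbτ.idx_zero, h9] at hb
    have hlen := htr.length_le hn
    refine (reach_runRound I hbτ rfl h9).mono le_rfl ?_
    rintro τ' ⟨hf', ⟨h9', hS, hend⟩ | ⟨h9', href, hswap⟩⟩
    · refine ⟨0, by omega, hf.trans hf', Or.inl ⟨h9', ?_⟩⟩
      rw [hS]
      exact ⟨htr.run, hend⟩
    · exact ⟨r - 1, by omega, hf.trans hf', Or.inr ⟨h9', s + 1, htr.succ href hswap, by omega⟩⟩
  · intro i hi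
    simp [State.setIdx, show i ≠ 9 by omega]
  · simp [State.setIdx]
  · change I.Trace Y 0 (σ.sets 2)
    rw [h2]
    exact .zero
  · omega
  · rintro τ ⟨⟨r, hf, h9⟩, hb⟩
    have hbτ := h.frame hf
    rcases h9 with ⟨-, hrun⟩ | ⟨h9, -⟩
    · exact ⟨hf, hrun⟩
    · simp [Test.Holds, hbτ.idx_zero, h9] at hb

/-! ### The loop over all guesses. -/

/-- Set the output to set `2`. -/
def copyOutput (k : ℕ) : Program k :=
  forUpTo 8 (.ite (.mem 2 8) (.op (.insert 0 8)) (.op (.erase 0 8)))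

/-- Set the output to set `2` if this increases its value. -/
def updateOutput (k : ℕ) : Program k :=
  .seq (.op (.value 8 2)) (.ite (.realLt 12 8) (.seq (copyOutput k) (.op (.move 12 8))) .skip)

/-- Try the guess that consists of the elements with numbers in index `2` and index `3`. -/
def tryGuess (k : ℕ) : Program k :=
  .seq (forUpTo 8 (block [.erase 1 8, .erase 2 8]))
    (.seq (block [.insert 1 2, .insert 1 3, .insert 2 2, .insert 2 3, .value 9 1, .times 3 13 9])
      (.seq (sumSize k) (.ite (.realLt 2 5) .skip
        (ifIndep 2 (.seq (.ite (.idxEq 2 3) .skip (runGuess k)) (updateOutput k))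
          (List.finRange k)))))

/-- The modified algorithm. -/
def matKnap (k : ℕ) : Program k :=
  .seq (block [.groundSize 1, .lit 10 1, .lit 11 4])
    (.seq (forUpTo 8 (.op (.plus 13 13 10)))
      (.seq (block [.times 0 13 13, .times 0 11 0, .plus 1 0 10, .bound 2, .value 12 0])
        (forUpTo 2 (forUpTo 3 (.ite (.idxLt 2 3) .skip (tryGuess k))))))

/-- The memory between two guesses. -/
structure Idle (I : Problem k n) (σ : State n) : Prop where
  idx_zero : σ.idx 0 = 0
  idx_size : σ.idx 1 = n
  idx_removed : σ.idx 7 = 0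
  real_scale : σ.real 0 = 4 * (n : ℝ) ^ 2
  real_scale_succ : σ.real 1 = 4 * (n : ℝ) ^ 2 + 1
  real_bound : σ.real 2 = I.B
  real_output : σ.real 12 = I.f (σ.sets 0)
  real_ground : σ.real 13 = n

/-- `S` is a possible output if only the guesses that satisfy `P` are tried. -/
def Tried (I : Problem k n) (P : Finset (Fin n) → Prop) (S : Finset (Fin n)) : Prop :=
  ∃ R : Finset (Fin n) → Finset (Fin n),
    (∀ Y, P Y → I.IsGuess Y → I.GuessResult (1 / 4) Y (R Y)) ∧
    (∃ Y, I.IsGuess Y ∧ S = R Y ∧ P Y) ∧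
    ∀ Y, P Y → I.IsGuess Y → I.f (R Y) ≤ I.f S

theorem Tried.congr {I : Problem k n} {P P' : Finset (Fin n) → Prop} {S : Finset (Fin n)}
    (h : Tried I P S) (hP : ∀ Y, P Y ↔ P' Y) : Tried I P' S := by
  have : P = P' := funext fun Y => propext (hP Y)
  rwa [← this]

theorem Tried.infeasible {I : Problem k n} {P : Finset (Fin n) → Prop} {S Y : Finset (Fin n)}
    (h : Tried I P S) (hY : ¬ I.Feasible Y) : Tried I (fun Z => P Z ∨ Z = Y) S := by
  obtain ⟨R, h1, ⟨Z, h2, h3, h4⟩, h5⟩ := h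
  have hne : ∀ {Z}, Z = Y → ¬ I.IsGuess Z := fun hZ hg => hY (hZ ▸ hg.2)
  refine ⟨R, fun Z hZ hg => hZ.elim (fun hZ => h1 Z hZ hg) fun hZ => absurd hg (hne hZ),
    ⟨Z, h2, h3, Or.inl h4⟩,
    fun Z hZ hg => hZ.elim (fun hZ => h5 Z hZ hg) fun hZ => absurd hg (hne hZ)⟩

/-- The function choosing the results is altered at `Y` only, and `Y` must be new so that no earlier
result is overwritten. -/
theorem Tried.extend {I : Problem k n} {P : Finset (Fin n) → Prop} {S Y S' : Finset (Fin n)}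
    (h : Tried I P S) (hP : ¬ P Y) (hY : I.IsGuess Y) (hS' : I.GuessResult (1 / 4) Y S') :
    (I.f S' ≤ I.f S → Tried I (fun Z => P Z ∨ Z = Y) S) ∧
      (I.f S ≤ I.f S' → Tried I (fun Z => P Z ∨ Z = Y) S') := by
  classical
  obtain ⟨R, h1, ⟨Z, h2, h3, h4⟩, h5⟩ := h
  have hR : ∀ W, P W → Function.update R Y S' W = R W := fun W hW =>
    Function.update_of_ne (by rintro rfl; exact hP hW) _ _
  have hres : ∀ W, (P W ∨ W = Y) → I.IsGuess W →
      I.GuessResult (1 / 4) W (Function.update R Y S' W) := by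
    rintro W (hW | rfl) hg
    · rw [hR W hW]; exact h1 W hW hg
    · rwa [Function.update_self]
  refine ⟨fun hle => ⟨_, hres, ⟨Z, h2, by rw [hR Z h4, h3], Or.inl h4⟩, ?_⟩,
    fun hle => ⟨_, hres, ⟨Y, hY, by rw [Function.update_self], Or.inr rfl⟩, ?_⟩⟩
  · rintro W (hW | rfl) hg
    · rw [hR W hW]; exact h5 W hW hg
    · rwa [Function.update_self]
  · rintro W (hW | rfl) hg
    · rw [hR W hW]; exact (h5 W hW hg).trans hle
    · rw [Function.update_self]

theorem reach_copyOutput (I : Problem k n) {σ : State n} (h1 : σ.idx 1 = n) :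
    Reach I (copyOutput k) σ (n * 4 + 2) fun τ => τ.sets 0 = σ.sets 2 ∧ τ.real = σ.real ∧
      ∀ i, i ≠ 8 → τ.idx i = σ.idx i := by
  refine Reach.forUpTo (t₁ := 2) (fun m τ => τ.sets 2 = σ.sets 2 ∧ τ.real = σ.real ∧
    (∀ i, i ≠ 8 → τ.idx i = σ.idx i) ∧
    ∀ u : Fin n, u.val < m → (u ∈ τ.sets 0 ↔ u ∈ σ.sets 2)) (by omega) h1 ?_ ?_ ?_ le_rfl
  · exact ⟨rfl, rfl, fun i hi => by simp [State.setIdx, hi], fun u hu => by omega⟩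
  · rintro m hm τ hτm hτ1 ⟨hs, hr, hi, hu⟩
    have hidx : ∀ τ' : State n, τ'.idx = τ.idx → ∀ i, i ≠ 8 →
        (τ'.setIdx 8 (m + 1)).idx i = σ.idx i := by
      intro τ' h i h8
      simp [State.setIdx, h8, h, hi i h8]
    refine Reach.ite (t₁ := 1) (fun hmem => ?_) (fun hmem => ?_) le_rfl
    · obtain ⟨h3, h4⟩ := hmem
      simp only [hτm, hs] at h4
      refine Reach.op ?_ le_rfl
      simp only [Instr.apply, hτm, hm, dif_pos, State.setSet]
      refine ⟨trivial, hτ1, ?_, hr, hidx _ rfl, fun u hum => ?_⟩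
      · simpa [State.setIdx] using hs
      · simp only [State.setIdx, Function.update_self, Finset.mem_insert]
        rcases Nat.lt_succ_iff_lt_or_eq.1 hum with hlt | heq
        · rw [hu u hlt]
          simp only [Fin.ext_iff]
          have : u.val ≠ m := by omega
          tauto
        · obtain rfl : u = ⟨m, hm⟩ := Fin.ext heq
          simp [h4]
    · have h4 : (⟨m, hm⟩ : Fin n) ∉ σ.sets 2 := fun h => hmem ⟨by rw [hτm]; exact hm, by
        simpa only [hτm, hs] using h⟩
      refine Reach.op ?_ le_rfl
      simp only [Instr.apply, hτm, hm, dif_pos, State.setSet]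
      refine ⟨trivial, hτ1, ?_, hr, hidx _ rfl, fun u hum => ?_⟩
      · simpa [State.setIdx] using hs
      · simp only [State.setIdx, Function.update_self, Finset.mem_erase]
        rcases Nat.lt_succ_iff_lt_or_eq.1 hum with hlt | heq
        · rw [hu u hlt]
          simp only [Fin.ext_iff, ne_eq]
          have : u.val ≠ m := by omega
          tauto
        · obtain rfl : u = ⟨m, hm⟩ := Fin.ext heq
          simp [h4]
  · rintro τ - ⟨-, hr, hi, hu⟩
    exact ⟨Finset.ext fun u => hu u u.2, hr, hi⟩

theorem reach_updateOutput (I : Problem k n) {P : Finset (Fin n) → Prop} {Y : Finset (Fin n)}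
    {σ : State n} (h : Idle I σ) (ht : Tried I P (σ.sets 0)) (hP : ¬ P Y) (hY : I.IsGuess Y)
    (hres : I.GuessResult (1 / 4) Y (σ.sets 2)) :
    Reach I (updateOutput k) σ (n * 4 + 5) fun τ => Idle I τ ∧ τ.idx 2 = σ.idx 2 ∧
      τ.idx 3 = σ.idx 3 ∧ Tried I (fun Z => P Z ∨ Z = Y) (τ.sets 0) := by
  have hext := ht.extend hP hY hres
  refine Reach.seq 1 (n * 4 + 4) (Reach.op ?_ le_rfl) (by omega)
  simp only [Instr.apply, State.setReal]
  refine Reach.ite (t₁ := n * 4 + 3) (fun hlt => ?_) (fun hlt => ?_) le_rfl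
  · simp [Test.Holds, h.real_output] at hlt
    refine Reach.seq (n * 4 + 2) 1 ((reach_copyOutput I (by simp [h.idx_size])).mono le_rfl ?_)
      le_rfl
    rintro τ ⟨h0, hr, hi⟩
    simp only at h0 hr hi
    refine Reach.op ⟨⟨?_, ?_, ?_, ?_, ?_, ?_, ?_, ?_⟩, ?_, ?_, ?_⟩ le_rfl
    all_goals simp only [Instr.apply, State.setReal, hr]
    · simp [hi, h.idx_zero]
    · simp [hi, h.idx_size]
    · simp [hi, h.idx_removed]
    · simp [h.real_scale]
    · simp [h.real_scale_succ]
    · simp [h.real_bound]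
    · simp [h0]
    · simp [h.real_ground]
    · simp [hi]
    · simp [hi]
    · rw [h0]; exact hext.2 hlt.le
  · simp [Test.Holds, h.real_output] at hlt
    refine Reach.skip ⟨⟨h.idx_zero, h.idx_size, h.idx_removed, ?_, ?_, ?_, ?_, ?_⟩, rfl, rfl,
      hext.1 hlt⟩ (by omega)
    · simp [h.real_scale]
    · simp [h.real_scale_succ]
    · simp [h.real_bound]
    · simp [h.real_output]
    · simp [h.real_ground]

/-- A bound on the running time for one guess. -/
def guessTime (k n : ℕ) : ℕ := runTime k n + n * 15 + k + 30

theorem reach_tryGuess (I : Problem k n) {P : Finset (Fin n) → Prop} {u v : Fin n}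
    {σ : State n} (h : Idle I σ) (hu : σ.idx 2 = u) (hv : σ.idx 3 = v)
    (ht : Tried I P (σ.sets 0)) (hP : ¬ P {u, v}) :
    Reach I (tryGuess k) σ (guessTime k n) fun τ => Idle I τ ∧ τ.idx 2 = u ∧ τ.idx 3 = v ∧
      Tried I (fun Z => P Z ∨ Z = {u, v}) (τ.sets 0) := by
  have hn : 0 < n := u.pos
  let Y : Finset (Fin n) := {u, v}
  refine Reach.seq (n * 5 + 2) (runTime k n + n * 10 + k + 28)
    (Reach.forUpTo (t₁ := 3) (fun m τ => τ.sets 0 = σ.sets 0 ∧ τ.real = σ.real ∧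
      (∀ i, i ≠ 8 → τ.idx i = σ.idx i) ∧
      (∀ w : Fin n, w.val < m → w ∉ τ.sets 1) ∧ ∀ w : Fin n, w.val < m → w ∉ τ.sets 2)
    (Q := fun τ => τ.sets 0 = σ.sets 0 ∧ τ.real = σ.real ∧ (∀ i, i ≠ 8 → τ.idx i = σ.idx i) ∧
      τ.sets 1 = ∅ ∧ τ.sets 2 = ∅) (by omega) h.idx_size ?_ ?_ ?_ le_rfl |>.mono le_rfl ?_)
    (by simp only [guessTime]; omega)
  · exact ⟨rfl, rfl, fun i hi => by simp [State.setIdx, hi], fun w hw => by omega,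
      fun w hw => by omega⟩
  · rintro m hm τ hτm hτ1 ⟨hs, hr, hi, hs1, hs2⟩
    refine Reach.block ?_ (by simp)
    simp only [List.foldl, Instr.apply, hτm, hm, dif_pos, State.setSet]
    refine ⟨trivial, hτ1, ?_, hr, fun i h8 => ?_, fun w hw hmem => ?_, fun w hw hmem => ?_⟩
    · simpa [State.setIdx] using hs
    · simp [State.setIdx, h8, hi i h8]
    · simp [State.setIdx, Fin.ext_iff] at hmem
      exact hs1 w (by omega) hmem.2
    · simp [State.setIdx, Fin.ext_iff] at hmem
      exact hs2 w (by omega) hmem.2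
  · rintro τ - ⟨hs, hr, hi, hs1, hs2⟩
    exact ⟨hs, hr, hi, Finset.eq_empty_of_forall_notMem fun w => hs1 w w.2,
      Finset.eq_empty_of_forall_notMem fun w => hs2 w w.2⟩
  rintro τ ⟨hs, hr, hi, hs1, hs2⟩
  have hi2 : τ.idx 2 = u := by rw [hi 2 (by omega), hu]
  have hi3 : τ.idx 3 = v := by rw [hi 3 (by omega), hv]
  refine Reach.seq 7 (runTime k n + n * 10 + k + 21) (Reach.block ?_ (by simp)) (by omega)
  have hσ' : List.foldl (fun τ (a : Instr) => a.apply I τ) τ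
      [.insert 1 2, .insert 1 3, .insert 2 2, .insert 2 3, .value 9 1, .times 3 13 9] =
      ⟨τ.idx, Function.update (Function.update σ.real 9 (I.f Y)) 3 (n * I.f Y),
        Function.update (Function.update τ.sets 1 Y) 2 Y⟩ := by
    have hY : ({v, u} : Finset (Fin n)) = Y := Finset.pair_comm v u
    simp [List.foldl, Instr.apply, State.setReal, State.setSet, hi2, hi3, hs1, hs2, hr,
      h.real_ground, hY]
  rw [hσ']
  refine Reach.seq (n * 6 + 3) (runTime k n + n * 4 + k + 18) ((reach_sumSize I ?_).mono le_rfl ?_)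
    (by omega)
  · change τ.idx 1 = n
    rw [hi 1 (by omega), h.idx_size]
  rintro υ ⟨hυs, hυi, hυr, hυ5⟩
  simp only at hυs hυi hυr
  have e1 : υ.sets 1 = Y := by rw [hυs]; simp
  have e2 : υ.sets 2 = Y := by rw [hυs]; simp
  have e0 : υ.sets 0 = σ.sets 0 := by rw [hυs]; simp [hs]
  have ei : ∀ i, i ≠ 8 → υ.idx i = σ.idx i := fun i h8 => (hυi i h8).trans (hi i h8)
  have er : ∀ r, r ≠ 3 → r ≠ 5 → r ≠ 9 → υ.real r = σ.real r := fun r h3 h5 h9 => by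
    rw [hυr r h5 h9]; simp [h3, h9]
  have e3 : υ.real 3 = n * I.f Y := by rw [hυr 3 (by omega) (by omega)]; simp
  have e5 : υ.real 5 = I.size Y := by rw [hυ5]; simp
  have hidle : Idle I υ := {
    idx_zero := by rw [ei 0 (by omega), h.idx_zero]
    idx_size := by rw [ei 1 (by omega), h.idx_size]
    idx_removed := by rw [ei 7 (by omega), h.idx_removed]
    real_scale := by rw [er 0 (by omega) (by omega) (by omega), h.real_scale]
    real_scale_succ := by rw [er 1 (by omega) (by omega) (by omega), h.real_scale_succ]
    real_bound := by rw [er 2 (by omega) (by omega) (by omega), h.real_bound]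
    real_output := by rw [er 12 (by omega) (by omega) (by omega), h.real_output, e0]
    real_ground := by rw [er 13 (by omega) (by omega) (by omega), h.real_ground] }
  have hbase : Base I Y υ := {
    guess := e1
    idx_zero := hidle.idx_zero
    idx_size := hidle.idx_size
    idx_removed := hidle.idx_removed
    real_scale := hidle.real_scale
    real_scale_succ := hidle.real_scale_succ
    real_bound := hidle.real_bound
    real_refute := e3 }
  have hυ2 : υ.idx 2 = u := by rw [ei 2 (by omega), hu]
  have hυ3 : υ.idx 3 = v := by rw [ei 3 (by omega), hv]
  have htυ : Tried I P (υ.sets 0) := by rwa [e0]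
  have hfail : ¬ I.Feasible Y → Idle I υ ∧ υ.idx 2 = u ∧ υ.idx 3 = v ∧
      Tried I (fun Z => P Z ∨ Z = {u, v}) (υ.sets 0) := fun hY =>
    ⟨hidle, hυ2, hυ3, htυ.infeasible hY⟩
  refine Reach.ite (t₁ := runTime k n + n * 4 + k + 17) (fun hB => ?_) (fun hB => ?_) le_rfl
  · refine Reach.skip (hfail fun hF => ?_) (by omega)
    simp only [Test.Holds, hidle.real_bound, e5] at hB
    exact absurd hF.2 (not_le.2 hB)
  simp only [Test.Holds, hidle.real_bound, e5, not_lt] at hB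
  refine Reach.ifIndep (t₁ := runTime k n + n * 4 + 8) (fun hI => ?_) (fun hI => ?_) (by omega)
  swap
  · exact hfail fun hF => hI (by rw [e2]; exact hF.1)
  rw [e2] at hI
  have hguess : I.IsGuess Y := ⟨Finset.card_le_two, hI, hB⟩
  refine Reach.seq (runTime k n + 2) (n * 4 + 5) (Reach.mono
    (Q := fun τ => Frame υ τ ∧ I.GuessResult (1 / 4) Y (τ.sets 2)) ?_ le_rfl ?_) (by omega)
  · refine Reach.ite (t₁ := runTime k n + 1) (fun heq => ?_) (fun hne => ?_) le_rfl
    · refine Reach.skip ⟨Frame.refl υ, ?_⟩ (by omega)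
      simp only [Test.Holds, hυ2, hυ3] at heq
      obtain rfl : u = v := Fin.ext heq
      have hc : Y.card ≠ 2 := by simp [Y]
      rw [Problem.GuessResult, if_neg hc, e2]
    · refine (reach_runGuess I hn hbase e2).mono (by omega) ?_
      rintro τ' ⟨hf, hrun⟩
      have hc : Y.card = 2 := Finset.card_pair fun huv => hne (by
        simp only [Test.Holds, hυ2, hυ3, huv])
      exact ⟨hf, by rwa [Problem.GuessResult, if_pos hc]⟩
  · rintro τ' ⟨hf, hres⟩
    have hidle' : Idle I τ' := {
      idx_zero := by rw [hf.idx 0 (by omega), hidle.idx_zero]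
      idx_size := by rw [hf.idx 1 (by omega), hidle.idx_size]
      idx_removed := by rw [hf.idx 7 (by omega), hidle.idx_removed]
      real_scale := by rw [hf.real 0 (by omega), hidle.real_scale]
      real_scale_succ := by rw [hf.real 1 (by omega), hidle.real_scale_succ]
      real_bound := by rw [hf.real 2 (by omega), hidle.real_bound]
      real_output := by rw [hf.real 12 (by omega), hidle.real_output, hf.output]
      real_ground := by rw [hf.real 13 (by omega), hidle.real_ground] }
    refine (reach_updateOutput I hidle' (by rwa [hf.output]) hP hguess hres).mono le_rfl ?_
    rintro τ'' ⟨h1, h2, h3, h4⟩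
    exact ⟨h1, by rw [h2, hf.idx 2 (by omega), hυ2], by rw [h3, hf.idx 3 (by omega), hυ3], h4⟩

/-- A bound on the running time of the modified algorithm. -/
def totalTime (k n : ℕ) : ℕ := n * (n * (guessTime k n + 3) + 7) + 20

theorem tried_empty (I : Problem k n) : Tried I (fun Z => Z = ∅) ∅ := by
  have hg : I.IsGuess ∅ := ⟨by simp, I.feasible_empty⟩
  refine ⟨fun Z => Z, ?_, ⟨∅, hg, rfl, rfl⟩, ?_⟩
  · rintro Y rfl -
    simp [Problem.GuessResult]
  · rintro Y rfl -
    exact le_rfl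

theorem Tried.isOutput {I : Problem k n} {P : Finset (Fin n) → Prop} {S : Finset (Fin n)}
    (h : Tried I P S) (hP : ∀ Y, I.IsGuess Y → P Y) : I.IsOutput (1 / 4) S := by
  obtain ⟨R, h1, ⟨Y, h2, h3, -⟩, h4⟩ := h
  exact ⟨R, fun Y hY => h1 Y (hP Y hY) hY, ⟨Y, h2, h3⟩, fun Y hY => h4 Y (hP Y hY) hY⟩

/-- Ordered indices make every guess occur once, as `Tried.extend` demands. -/
theorem pair_injective_of_le {a b u v : Fin n} (hab : b ≤ a) (huv : v ≤ u)
    (h : ({a, b} : Finset (Fin n)) = {u, v}) : a = u ∧ b = v := by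
  have h1 : a ∈ ({u, v} : Finset (Fin n)) := h ▸ Finset.mem_insert_self _ _
  have h2 : b ∈ ({u, v} : Finset (Fin n)) :=
    h ▸ Finset.mem_insert_of_mem (Finset.mem_singleton_self _)
  have h3 : u ∈ ({a, b} : Finset (Fin n)) := h.symm ▸ Finset.mem_insert_self _ _
  have h4 : v ∈ ({a, b} : Finset (Fin n)) :=
    h.symm ▸ Finset.mem_insert_of_mem (Finset.mem_singleton_self _)
  simp only [Finset.mem_insert, Finset.mem_singleton, Fin.ext_iff, Fin.le_def] at *
  omega

/-- The guesses that are tried before the pair with numbers `(p, q)`. -/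
def TriedBefore (n p q : ℕ) (Z : Finset (Fin n)) : Prop :=
  Z = ∅ ∨ ∃ a b : Fin n, b ≤ a ∧ (a.val < p ∨ a.val = p ∧ b.val < q) ∧ Z = {a, b}

theorem Idle.setIdx {I : Problem k n} {σ : State n} (h : Idle I σ) {i : ℕ} (hi : i = 2 ∨ i = 3)
    (v : ℕ) : Idle I (σ.setIdx i v) where
  idx_zero := by simp [State.setIdx, show 0 ≠ i by omega, h.idx_zero]
  idx_size := by simp [State.setIdx, show 1 ≠ i by omega, h.idx_size]
  idx_removed := by simp [State.setIdx, show 7 ≠ i by omega, h.idx_removed]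
  real_scale := h.real_scale
  real_scale_succ := h.real_scale_succ
  real_bound := h.real_bound
  real_output := h.real_output
  real_ground := h.real_ground

/-- The diagonal pairs supply the singletons, and the initially empty output supplies the empty
guess. -/
theorem reach_guesses (I : Problem k n) {σ : State n} (h : Idle I σ) (h0 : σ.sets 0 = ∅) :
    Reach I (forUpTo 2 (forUpTo 3 (.ite (.idxLt 2 3) .skip (tryGuess k)))) σ
      (n * (n * (guessTime k n + 3) + 4) + 2) fun τ => I.IsOutput (1 / 4) (τ.sets 0) := by
  refine Reach.forUpTo (t₁ := n * (guessTime k n + 3) + 2) (fun p τ => Idle I τ ∧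
    Tried I (TriedBefore n p 0) (τ.sets 0)) (by omega) h.idx_size ?_ ?_ ?_ le_rfl
  · refine ⟨h.setIdx (Or.inl rfl) 0, ?_⟩
    change Tried I _ (σ.sets 0)
    rw [h0]
    refine (tried_empty I).congr fun Y => ?_
    simp [TriedBefore]
  · rintro p hp τ hτ2 hτ1 ⟨hidle, htried⟩
    refine Reach.forUpTo (t₁ := guessTime k n + 1) (fun q τ' => Idle I τ' ∧ τ'.idx 2 = p ∧
      Tried I (TriedBefore n p q) (τ'.sets 0)) (by omega) hτ1 ?_ ?_ ?_ le_rfl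
    · exact ⟨hidle.setIdx (Or.inr rfl) 0, by simp [State.setIdx, hτ2], htried⟩
    · rintro q hq τ' hτ'3 hτ'1 ⟨hidle', hτ'2, htried'⟩
      refine Reach.ite (t₁ := guessTime k n) (fun hlt => ?_) (fun hlt => ?_) le_rfl
      · simp only [Test.Holds, hτ'2, hτ'3] at hlt
        refine Reach.skip ⟨hτ'3, hτ'1, hidle'.setIdx (Or.inr rfl) _, by
          simp [State.setIdx, hτ'2], htried'.congr fun Y => or_congr_right ?_⟩
          (by simp only [guessTime]; omega)
        refine exists₂_congr fun a b => and_congr_right fun hba => and_congr_left fun _ => ?_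
        rw [Fin.le_def] at hba
        omega
      · simp only [Test.Holds, hτ'2, hτ'3, not_lt] at hlt
        have hnew : ¬ TriedBefore n p q {(⟨p, hp⟩ : Fin n), ⟨q, hq⟩} := by
          rintro (he | ⟨a, b, hba, hab, he⟩)
          · simp at he
          · obtain ⟨rfl, rfl⟩ := pair_injective_of_le (Fin.le_def.2 hlt) hba he
            simp at hab
        refine (reach_tryGuess I hidle' (u := ⟨p, hp⟩) (v := ⟨q, hq⟩) hτ'2 hτ'3 htried'
          hnew).mono le_rfl ?_
        rintro υ ⟨hi, h2, h3, ht⟩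
        refine ⟨h3, hi.idx_size, hi.setIdx (Or.inr rfl) _, by simp [State.setIdx, h2],
          ht.congr fun Y => ?_⟩
        constructor
        · rintro ((hY | ⟨a, b, hba, hab, hY⟩) | hY)
          · exact Or.inl hY
          · exact Or.inr ⟨a, b, hba, by omega, hY⟩
          · exact Or.inr ⟨⟨p, hp⟩, ⟨q, hq⟩, Fin.le_def.2 hlt, Or.inr ⟨rfl, by simp⟩, hY⟩
        · rintro (hY | ⟨a, b, hba, hab, hY⟩)
          · exact Or.inl (Or.inl hY)
          · by_cases hc : a.val < p ∨ a.val = p ∧ b.val < q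
            · exact Or.inl (Or.inr ⟨a, b, hba, hc, hY⟩)
            · right
              rw [hY, show a = ⟨p, hp⟩ from Fin.ext (by simp only; omega),
                show b = ⟨q, hq⟩ from Fin.ext (by simp only; omega)]
    · rintro τ' - ⟨hidle', h2, ht⟩
      refine ⟨h2, hidle'.idx_size, hidle'.setIdx (Or.inl rfl) _, ht.congr fun Y =>
        or_congr_right (exists₂_congr fun a b => and_congr_right fun hba =>
          and_congr_left fun _ => ?_)⟩
      rw [Fin.le_def] at hba
      have := b.2
      omega
  · rintro τ - ⟨-, ht⟩
    refine ht.isOutput fun Y hY => ?_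
    have hc := hY.1
    rcases Nat.lt_or_ge 1 Y.card with h1 | h1
    · obtain ⟨a, b, -, rfl⟩ := Finset.card_eq_two.1 (show Y.card = 2 by omega)
      rcases le_total b a with hba | hba
      · exact Or.inr ⟨a, b, hba, Or.inl a.2, rfl⟩
      · exact Or.inr ⟨b, a, hba, Or.inl b.2, Finset.pair_comm a b⟩
    · rcases Y.eq_empty_or_nonempty with rfl | hne
      · exact Or.inl rfl
      · obtain ⟨a, rfl⟩ := Finset.card_eq_one.1 (le_antisymm h1 hne.card_pos)
        exact Or.inr ⟨a, a, le_rfl, Or.inl a.2, by simp⟩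

/-- The real number `n` is built by adding 1 in a loop, since no instruction moves an index into a
real register. The output value starts as `f ∅`. -/
theorem reach_matKnap (I : Problem k n) :
    Reach I (matKnap k) (State.init n) (totalTime k n) fun τ => I.IsOutput (1 / 4) (τ.sets 0) := by
  refine Reach.seq 4 (n * (n * (guessTime k n + 3) + 7) + 16) (Reach.block ?_ (by simp))
    (by simp only [totalTime]; omega)
  simp only [List.foldl, Instr.apply, State.setReal, State.setIdx, State.init]
  refine Reach.seq (n * 3 + 2) (n * (n * (guessTime k n + 3) + 4) + 14) (Reach.forUpTo (t₁ := 1)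
    (fun m τ => τ.sets 0 = ∅ ∧ τ.real 13 = m ∧ τ.real 10 = 1 ∧ τ.real 11 = 4 ∧ τ.idx 0 = 0 ∧
      τ.idx 7 = 0 ∧ τ.idx 1 = n)
    (Q := fun τ => τ.sets 0 = ∅ ∧ τ.real 13 = n ∧ τ.real 10 = 1 ∧ τ.real 11 = 4 ∧ τ.idx 0 = 0 ∧
      τ.idx 7 = 0 ∧ τ.idx 1 = n) (by omega) (by simp) ?_ ?_ ?_ le_rfl |>.mono le_rfl ?_)
    (by nlinarith)
  · simp [State.setIdx]
  · rintro m hm τ hτ8 hτ1 ⟨h1, h2, h3, h4, h5, h6, h7⟩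
    refine Reach.op ?_ le_rfl
    simp [Instr.apply, State.setReal, State.setIdx, h1, h2, h3, h4, h5, h6, h7, hτ8]
  · rintro τ - h
    exact h
  rintro τ ⟨h1, h2, h3, h4, h5, h6, h7⟩
  refine Reach.seq 6 (n * (n * (guessTime k n + 3) + 4) + 2) (Reach.block ?_ (by simp)) (by omega)
  simp only [List.foldl, Instr.apply, State.setReal]
  refine reach_guesses I ⟨?_, ?_, ?_, ?_, ?_, ?_, ?_, ?_⟩ ?_
  · exact h5
  · exact h7
  · exact h6
  · simp [h2, h4]; ring
  · simp [h2, h3, h4]; ring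
  · simp
  · simp
  · simp [h2]
  · exact h1

/-! ### Asymptotics of the running time. -/

/-- Up to the additive 20, each level multiplies the time by `n + 1`. -/
theorem enumTime_le (k n j : ℕ) : enumTime k n j ≤ (2 * k + 30 + 20 * j) * (n + 1) ^ j := by
  induction j with
  | zero => simp [enumTime]
  | succ j ih =>
    have h1 : 1 ≤ (n + 1) ^ j := Nat.one_le_pow _ _ (by omega)
    calc enumTime k n (j + 1) ≤ (enumTime k n j + 20) * (n + 1) := by
          simp only [enumTime]; nlinarith
      _ ≤ ((2 * k + 30 + 20 * j) * (n + 1) ^ j + 20 * (n + 1) ^ j) * (n + 1) := by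
          refine Nat.mul_le_mul_right _ ?_
          omega
      _ = _ := by ring

/-- The exponents add up as `2` for the guesses, `2` for the swaps of a run (with the logarithm),
and `k + 1` for a round. Powers of `n + 1` keep the bound valid at `n = 0`. -/
theorem totalTime_le (k : ℕ) :
    ∃ C : ℕ, ∀ n, totalTime k n ≤ C * ((n + 1) ^ (k + 5) * (Nat.log 2 n + 1)) := by
  have hround : ∀ n, roundTime k n + 1 ≤ (23 * k + 60) * (n + 1) ^ (k + 1) := by
    intro n
    have h1 := enumTime_le k n k
    have h2 : 1 ≤ (n + 1) ^ k := Nat.one_le_pow _ _ (by omega)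
    calc roundTime k n + 1 ≤ (enumTime k n k + 9 + k + 21) * (n + 1) := by
          simp only [roundTime]; nlinarith
      _ ≤ ((2 * k + 30 + 20 * k) * (n + 1) ^ k + (k + 30) * (n + 1) ^ k) * (n + 1) := by
          refine Nat.mul_le_mul_right _ ?_
          have : k + 30 ≤ (k + 30) * (n + 1) ^ k := Nat.le_mul_of_pos_right _ h2
          omega
      _ = (23 * k + 60) * (n + 1) ^ (k + 1) := by ring
  have hswaps : ∀ n, maxSwaps k n + 1 ≤ (4 * k + 6) * ((n + 1) ^ 2 * (Nat.log 2 n + 1)) := by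
    intro n
    simp only [maxSwaps]
    have h1 : n ^ 2 * (Nat.log 2 n + 1) ≤ (n + 1) ^ 2 * (Nat.log 2 n + 1) :=
      Nat.mul_le_mul_right _ (Nat.pow_le_pow_left (by omega) 2)
    have h2 : (n + 1) ^ 2 ≤ (n + 1) ^ 2 * (Nat.log 2 n + 1) :=
      Nat.le_mul_of_pos_right _ (by omega)
    have h3 : n + 2 ≤ 2 * (n + 1) ^ 2 := by nlinarith
    have h4 : (k + 1) * (4 * n ^ 2 * (Nat.log 2 n + 1)) ≤
        (4 * k + 4) * ((n + 1) ^ 2 * (Nat.log 2 n + 1)) := by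
      calc (k + 1) * (4 * n ^ 2 * (Nat.log 2 n + 1)) =
            (4 * k + 4) * (n ^ 2 * (Nat.log 2 n + 1)) := by ring
        _ ≤ _ := Nat.mul_le_mul_left _ h1
    nlinarith
  refine ⟨(4 * k + 6) * (23 * k + 60) + k + 80, fun n => ?_⟩
  let C := (4 * k + 6) * (23 * k + 60)
  let W := (n + 1) ^ (k + 3) * (Nat.log 2 n + 1)
  have hW : n + 1 ≤ W := by
    calc n + 1 = (n + 1) ^ 1 * 1 := by ring
      _ ≤ W := Nat.mul_le_mul (Nat.pow_le_pow_right (by omega) (by omega)) (by omega)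
  have hrun : runTime k n ≤ C * W + 4 := by
    have := Nat.mul_le_mul (hswaps n) (hround n)
    simp only [runTime, C, W]
    calc _ ≤ (4 * k + 6) * ((n + 1) ^ 2 * (Nat.log 2 n + 1)) *
          ((23 * k + 60) * (n + 1) ^ (k + 1)) + 4 := by omega
      _ = _ := by ring
  have hguess : guessTime k n + 3 ≤ (C + k + 52) * W := by
    simp only [guessTime]
    have h1 : k ≤ k * W := Nat.le_mul_of_pos_right _ (by omega)
    nlinarith
  have hpos : 1 ≤ (n + 1) ^ 2 * W := by
    have : 0 < (n + 1) ^ 2 := by positivity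
    nlinarith
  have hinner : n * (guessTime k n + 3) + 7 ≤ (C + k + 59) * W * (n + 1) := by
    nlinarith
  calc totalTime k n ≤ (C + k + 59) * W * (n + 1) * (n + 1) + 20 := by
        simp only [totalTime]
        have := Nat.mul_le_mul_left n hinner
        nlinarith
    _ ≤ (C + k + 80) * ((n + 1) ^ 2 * W) := by nlinarith
    _ = _ := by simp only [W]; ring

theorem totalTime_softO (k : ℕ) : SoftO (totalTime k) fun n => (n : ℝ) ^ (k + 5) := by
  obtain ⟨C, hC⟩ := totalTime_le k
  -- One logarithm suffices. The factor `2 ^ (k + 5)` absorbs `n + 1 ≤ 2n`, and `2 / log 2` absorbs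
  -- the change of base and the `+ 1`, using `n ≥ 2`.
  refine ⟨1, Asymptotics.IsBigO.of_bound (C * (2 ^ (k + 5) * (2 / Real.log 2))) ?_⟩
  filter_upwards [Filter.eventually_ge_atTop 2] with n hn
  have hn1 : (1 : ℝ) ≤ n := by exact_mod_cast (by omega : 1 ≤ n)
  have hlog2 : 0 < Real.log 2 := Real.log_pos (by norm_num)
  have hlogn : Real.log 2 ≤ Real.log n :=
    Real.log_le_log (by norm_num) (by exact_mod_cast hn)
  have h1 : ((Nat.log 2 n : ℕ) : ℝ) * Real.log 2 ≤ Real.log n := by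
    rw [← Real.log_pow]
    refine Real.log_le_log (by positivity) ?_
    exact_mod_cast Nat.pow_log_le_self 2 (by omega)
  have h2 : (Nat.log 2 n : ℝ) + 1 ≤ 2 / Real.log 2 * Real.log n := by
    rw [div_mul_eq_mul_div, le_div_iff₀ hlog2]
    linarith
  have h3 : ((n : ℝ) + 1) ^ (k + 5) ≤ 2 ^ (k + 5) * (n : ℝ) ^ (k + 5) := by
    rw [← mul_pow]
    gcongr
    linarith
  have h4 : (0 : ℝ) ≤ (n : ℝ) ^ (k + 5) * Real.log n ^ 1 := by
    have : 0 ≤ Real.log n := hlog2.le.trans hlogn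
    positivity
  rw [Real.norm_of_nonneg (Nat.cast_nonneg _), Real.norm_of_nonneg h4, pow_one]
  calc (totalTime k n : ℝ) ≤ C * (((n : ℝ) + 1) ^ (k + 5) * ((Nat.log 2 n : ℝ) + 1)) := by
        exact_mod_cast hC n
    _ ≤ C * ((2 ^ (k + 5) * (n : ℝ) ^ (k + 5)) * (2 / Real.log 2 * Real.log n)) := by gcongr
    _ = _ := by ring

end MatKnap

theorem theorem4 (k : ℕ) (hk : 1 ≤ k) :
    ∃ ε : ℝ, 0 < ε ∧
      -- every output of the modified algorithm has the approximation ratio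
      (∀ (n : ℕ) (I : MatKnap.Problem k n) (S : Finset (Fin n)), I.IsOutput ε S →
        I.Feasible S ∧
          ∀ O : Finset (Fin n), I.Feasible O →
            (1 - Real.exp (-((k : ℝ) + 1))) / ((k : ℝ) + 1) * I.f O ≤ I.f S) ∧
      -- one program implements the modified algorithm within the time bound
      ∃ (p : MatKnap.Program k) (T : ℕ → ℕ),
        MatKnap.SoftO T (fun n => (n : ℝ) ^ (k + 5)) ∧
          ∀ (n : ℕ) (I : MatKnap.Problem k n),
            ∃ (t : ℕ) (S : Finset (Fin n)),
              MatKnap.Computes I p t S ∧ t ≤ T n ∧ I.IsOutput ε S := by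
  refine ⟨1 / 4, by norm_num, fun n I S hS =>
    ⟨I.output_feasible hS, fun O hO => I.output_ratio hk hS hO⟩,
    MatKnap.matKnap k, MatKnap.totalTime k, MatKnap.totalTime_softO k, fun n I => ?_⟩
  obtain ⟨t, τ, ht, hexec, hout⟩ := MatKnap.reach_matKnap I
  exact ⟨t, τ.sets 0, ⟨τ, hexec, rfl⟩, ht, hout⟩
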